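/- Let $E=(E^0,E^1,r,s)$ be a finite strongly connected directed graph, with adjacency matrix $A_E(v,w)=|\{e\in E^1: r(e)=v,\ s(e)=w\}|$. Write $E^k$ for the set of paths $\mu=e_1\cdots e_k$ with $s(e_i)=r(e_{i+1})$ (with $E^0$ the vertices, as paths of length $0$), $r(\mu)=r(e_1)$, $s(\mu)=s(e_k)$, $E^*=\bigcup_{k\ge0}E^k$, $vE^k=\{\mu\in E^k: r(\mu)=v\}$ and $vE^*=\bigcup_{k\ge 0}vE^k$. Let $\mathcal G$ be a discrete groupoid with unit space $E^0$, domain map $d$ and terminus map $t$, with a faithful self-similar action on $E$: each $g\in\mathcal G$ acts as a length-preserving bijection $d(g)E^*\to t(g)E^*$ with $g\cdot(\mu e)\in (g\cdot\mu)E^1$, the action is multiplicative, units act as identities, distinct elements with the same domain and terminus act differently, and for $\mu\in d(g)E^*$ there is a (unique) $g|_\mu\in\mathcal G$ with $d(g|_\mu)=s(\mu)$ and $g\cdot(\mu\nu)=(g\cdot\mu)(g|_\mu\cdot\nu)$ for all $\nu\in s(\mu)E^*$. Let $C^*(\mathcal G)$ be the full groupoid $C^*$-algebra, with generators $u_g$,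 and let $\mathcal T(\mathcal G,E)$ be the Toeplitz algebra of the action, that is, the universal unital $C^*$-algebra generated by partial isometries $u_g$ $(g\in\mathcal G)$ and elements $s_e$ $(e\in E^1)$ such that $u_gu_h=\delta_{d(g),t(h)}u_{gh}$, $u_{g^{-1}}=u_g^*$, $\sum_{v\in E^0}u_v=1$, $s_e^*s_e=u_{s(e)}$, $\sum_{r(e)=v}s_es_e^*\le u_v$ and $u_gs_e=\delta_{d(g),r(e)}s_{g\cdot e}u_{g|_e}$. Regard elements of $C^*(\mathcal G)$ as elements of $\mathcal T(\mathcal G,E)$ through the canonical unital $*$-homomorphism $u_g\mapsto u_g$, and put $s_\mu=s_{e_1}\cdots s_{e_k}$ for $\mu=e_1\cdots e_k$ and $s_v=u_v$ for $v\in E^0$. Let $\operatorname{Tr}(C^*(\mathcal G))$ be the set of tracial states of $C^*(\mathcal G)$, and for $\tau\in \operatorname{Tr}(C^*(\mathcal G))$ let $x^\tau=(\tau(u_v))_{v\in E^0}\in[0,1]^{E^0}$. Let $\beta\in\mathbb R$ with $\beta>\log\rho(A_E)$, where $\rho$ is the spectral radius and $\log 0=-\infty$. Then the following hold. (a) $I-e^{-\beta}A_E$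 is invertible; put $A_{vN}=(I-e^{-\beta}A_E)^{-1}$. (b) For every $\tau\in\operatorname{Tr}(C^*(\mathcal G))$ the series $Z(\beta,\tau)=\sum_{k\ge0}e^{-\beta k}\sum_{\mu\in E^k}\tau(u_{s(\mu)})$ converges to a positive number, and there is a unique state $\Psi_{\beta,\tau}$ of $\mathcal T(\mathcal G,E)$ such that, for all $\mu,\nu\in E^*$ and all $g\in\mathcal G$ with $d(g)=s(\nu)$ and $t(g)=s(\mu)$, $$\Psi_{\beta,\tau}(s_\mu u_gs_\nu^*)=\delta_{\mu,\nu}\,e^{-\beta|\mu|}Z(\beta,\tau)^{-1}\sum_{k\ge0}e^{-\beta k}\sum_{\lambda\in s(\mu)E^k,\ g\cdot\lambda=\lambda}\tau(u_{g|_\lambda}),$$ where for $\mu=\nu$ the series on the right converges. (c) There is a unique map $\chi_\beta:\operatorname{Tr}(C^*(\mathcal G))\to\operatorname{Tr}(C^*(\mathcal G))$ with $\chi_\beta(\tau)=\Psi_{\beta,\tau}|_{C^*(\mathcal G)}$ for all $\tau$, and for every $\tau\in\operatorname{Tr}(C^*(\mathcal G))$ and every integer $n\ge0$, $$x^{\chi_\beta^n(\tau)}=\|A_{vN}^n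 x^\tau\|_1^{-1}\,A_{vN}^n x^\tau .$$ -/

import Mathlib

open CategoryTheory
open scoped ENNReal

universe u

noncomputable section

namespace SelfSim

/-! ## Finite directed graphs and their paths

Paths are read from the range: `μ = e₁ e₂ ⋯ eₙ` with `s(eᵢ) = r(eᵢ₊₁)`, `r(μ) = r(e₁)` and
`s(μ) = s(eₙ)`.  A vertex is a path of length `0`. -/

/-- A directed graph with vertex set `V`, edge set `E₁`, and range and source maps. -/
structure DirectedGraph (V E₁ : Type u) where
  r : E₁ → V
  s : E₁ → V

namespace DirectedGraph

variable {V E₁ : Type u} (E : DirectedGraph V E₁)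

/-- The list `e₁, …, eₙ` is a path with range `v`; the empty list is the path `v` of length 0. -/
def IsPathFrom : V → List E₁ → Prop
  | _, [] => True
  | v, e :: l => E.r e = v ∧ IsPathFrom (E.s e) l

/-- The source of the path `e₁ ⋯ eₙ` with range `v`. -/
def listSource : V → List E₁ → V
  | v, [] => v
  | _, e :: l => listSource (E.s e) l

/-- `vE^*`, the set of paths (of any length `≥ 0`) with range `v`. -/
def Path (v : V) : Type u := {l : List E₁ // E.IsPathFrom v l}

variable {E}

/-- The source `s(μ)` of a path. -/
def Path.source {v : V} (μ : E.Path v) : V := E.listSource v μ.1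

/-- The length `|μ|` of a path. -/
def Path.length {v : V} (μ : E.Path v) : ℕ := μ.1.length

theorem isPathFrom_append : ∀ (l m : List E₁) (v : V),
    E.IsPathFrom v l → E.IsPathFrom (E.listSource v l) m → E.IsPathFrom v (l ++ m)
  | [], _, _, _, h => h
  | e :: l, m, _, h, h' => ⟨h.1, isPathFrom_append l m (E.s e) h.2 h'⟩

/-- The concatenation `μν`, for `ν ∈ s(μ)E^*`. -/
def Path.append {v : V} (μ : E.Path v) (ν : E.Path μ.source) : E.Path v :=
  ⟨μ.1 ++ ν.1, isPathFrom_append μ.1 ν.1 v μ.2 ν.2⟩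

variable (E)

/-- The edge `e` as a path of length one with range `r(e)`. -/
def edgePath (e : E₁) : E.Path (E.r e) := ⟨[e], rfl, trivial⟩

/-- `vE^k`, the set of paths of length `k` with range `v`. -/
def PathN (v : V) (k : ℕ) : Type u := {μ : E.Path v // μ.length = k}

instance [Fintype E₁] (v : V) (k : ℕ) : Fintype (E.PathN v k) :=
  have : Finite {l : List E₁ // l.length = k} := (List.finite_length_eq E₁ k).to_subtype
  have : Finite (E.PathN v k) :=
    Finite.of_injective (β := {l : List E₁ // l.length = k}) (fun μ => ⟨μ.1.1, μ.2⟩)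
      (fun _ _ h => Subtype.ext (Subtype.ext (Subtype.mk.inj h)))
  Fintype.ofFinite _

/-- `E` is strongly connected: `vE^*w` is nonempty for all vertices `v, w`. -/
def StronglyConnected : Prop := ∀ v w : V, ∃ μ : E.Path v, μ.source = w

open Classical in
/-- The adjacency matrix, `A_E(v,w) = |vE^1w|`. -/
def adjMatrix [Fintype E₁] : Matrix V V ℤ :=
  Matrix.of fun v w => (Fintype.card {e : E₁ // E.r e = v ∧ E.s e = w} : ℤ)

/-! ## Self-similar groupoid actions -/

/-- A partial isomorphism `vE^* → wE^*` of the forest `T_E`. -/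
structure PIso (v w : V) where
  toEquiv : E.Path v ≃ E.Path w
  length_eq : ∀ μ : E.Path v, (toEquiv μ).length = μ.length
  extend : ∀ (μ : E.Path v) (ν : E.Path μ.source), ν.length = 1 →
    ∃ ν' : E.Path (toEquiv μ).source, toEquiv (μ.append ν) = (toEquiv μ).append ν'

end DirectedGraph

/-- A faithful self-similar action on `T_E` of a discrete groupoid with unit space the vertex set
`V = E^0`.  A morphism `g : v ⟶ w` is a groupoid element with `d(g) = v` and `t(g) = w`, so the
groupoid product `hg` (first `g`, then `h`) is `g ≫ h`. -/
structure SelfSimilarAction {V E₁ : Type u} [Groupoid.{u} V] (E : DirectedGraph V E₁) where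
  /-- the homomorphism from the groupoid to the partial isomorphisms of `T_E` -/
  θ : ∀ {v w : V}, (v ⟶ w) → E.PIso v w
  map_id : ∀ (v : V) (μ : E.Path v), (θ (𝟙 v)).toEquiv μ = μ
  map_comp : ∀ {v w x : V} (g : v ⟶ w) (h : w ⟶ x) (μ : E.Path v),
    (θ (g ≫ h)).toEquiv μ = (θ h).toEquiv ((θ g).toEquiv μ)
  faithful : ∀ {v w : V}, Function.Injective (θ : (v ⟶ w) → E.PIso v w)
  selfSimilar : ∀ {v w : V} (g : v ⟶ w) (μ : E.Path v),
    ∃ h : μ.source ⟶ ((θ g).toEquiv μ).source, ∀ ν : E.Path μ.source,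
      (θ g).toEquiv (μ.append ν) = ((θ g).toEquiv μ).append ((θ h).toEquiv ν)

namespace SelfSimilarAction

variable {V E₁ : Type u} [Groupoid.{u} V] {E : DirectedGraph V E₁} (S : SelfSimilarAction E)

/-- `g · μ` -/
def act {v w : V} (g : v ⟶ w) (μ : E.Path v) : E.Path w := (S.θ g).toEquiv μ

/-- The restriction `g|_μ` (unique, by faithfulness). -/
def restr {v w : V} (g : v ⟶ w) (μ : E.Path v) : μ.source ⟶ (S.act g μ).source :=
  (S.selfSimilar g μ).choose

theorem act_append {v w : V} (g : v ⟶ w) (μ : E.Path v) (ν : E.Path μ.source) :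
    S.act g (μ.append ν) = (S.act g μ).append (S.act (S.restr g μ) ν) :=
  (S.selfSimilar g μ).choose_spec ν

end SelfSimilarAction

/-! ## Representations on Hilbert spaces -/

/-- A (unital) representation by partial isometries `v_g` of a groupoid with finite unit space `V`
on a nonzero Hilbert space: `v_g v_h = δ_{d(g),t(h)} v_{gh}`, `v_{g⁻¹} = v_g^*`, `∑_w v_w = 1`. -/
structure GroupoidRep (V : Type u) [Fintype V] [Groupoid.{u} V] where
  H : Type u
  [normedAddCommGroup : NormedAddCommGroup H]
  [innerProductSpace : InnerProductSpace ℂ H]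
  [completeSpace : CompleteSpace H]
  [nontrivial : Nontrivial H]
  v : ∀ {x y : V}, (x ⟶ y) → (H →L[ℂ] H)
  v_mul : ∀ {x y z : V} (h : x ⟶ y) (g : y ⟶ z), v g * v h = v (h ≫ g)
  v_mul_eq_zero : ∀ {x y y' z : V} (h : x ⟶ y) (g : y' ⟶ z), y' ≠ y → v g * v h = 0
  v_inv : ∀ {x y : V} (g : x ⟶ y), v (Groupoid.inv g) = star (v g)
  sum_v : ∑ w : V, v (𝟙 w) = 1

attribute [instance] GroupoidRep.normedAddCommGroup GroupoidRep.innerProductSpace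
  GroupoidRep.completeSpace GroupoidRep.nontrivial

open Classical in
/-- A Toeplitz representation `(v, q, t)` of a self-similar action on a nonzero Hilbert space, where
`q_w = v_w` for `w ∈ V`.  That the `q_w` are mutually orthogonal projections with sum `1`, that
the `v_g` are partial isometries, and that `v_g q_w = δ_{d(g),w} q_{g·w} v_g`, is contained in the
relations for `v`. -/
structure ToeplitzRep {V E₁ : Type u} [Fintype V] [Fintype E₁] [Groupoid.{u} V]
    {E : DirectedGraph V E₁} (S : SelfSimilarAction E) extends GroupoidRep V where
  t : E₁ → (H →L[ℂ] H)
  star_t_mul_t : ∀ e : E₁, star (t e) * t e = v (𝟙 (E.s e))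
  sum_t_mul_star_t_le : ∀ w : V,
    ∑ e : E₁ with E.r e = w, t e * star (t e) ≤ v (𝟙 w)
  v_mul_t : ∀ {w : V} (e f : E₁) (g : E.r e ⟶ w), (S.act g (E.edgePath e)).1 = [f] →
    v g * t e = t f * v (S.restr g (E.edgePath e))
  v_mul_t_eq_zero : ∀ {x y : V} (g : x ⟶ y) (e : E₁), x ≠ E.r e → v g * t e = 0

namespace GroupoidRep

variable {V : Type u} [Fintype V] [Groupoid.{u} V] (π : GroupoidRep V)

theorem star_v_mul_v {x y : V} (g : x ⟶ y) : star (π.v g) * π.v g = π.v (𝟙 x) := by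
  rw [← π.v_inv, π.v_mul, Groupoid.comp_inv]

theorem isStarProjection_v_id (x : V) : IsStarProjection (π.v (𝟙 x)) where
  isIdempotentElem := by
    have := π.v_mul (𝟙 x) (𝟙 x)
    rwa [Category.comp_id] at this
  isSelfAdjoint := by
    have := π.star_v_mul_v (𝟙 x)
    rw [← this]; exact IsSelfAdjoint.star_mul_self _

theorem norm_v_le {x y : V} (g : x ⟶ y) : ‖π.v g‖ ≤ 1 := by
  have h1 : ‖π.v g‖ * ‖π.v g‖ = ‖π.v (𝟙 x)‖ := by
    rw [← CStarRing.norm_star_mul_self, π.star_v_mul_v]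
  have h2 : ‖π.v (𝟙 x)‖ ≤ 1 := (π.isStarProjection_v_id x).norm_le
  nlinarith [norm_nonneg (π.v g)]

end GroupoidRep

theorem ToeplitzRep.norm_t_le {V E₁ : Type u} [Fintype V] [Fintype E₁] [Groupoid.{u} V]
    {E : DirectedGraph V E₁} {S : SelfSimilarAction E} (ρ : ToeplitzRep S) (e : E₁) :
    ‖ρ.t e‖ ≤ 1 := by
  have h1 : ‖ρ.t e‖ * ‖ρ.t e‖ = ‖ρ.v (𝟙 (E.s e))‖ := by
    rw [← CStarRing.norm_star_mul_self, ρ.star_t_mul_t]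
  have h2 := ρ.norm_v_le (𝟙 (E.s e))
  nlinarith [norm_nonneg (ρ.t e)]

/-! ## The universal C*-algebras

Each is the C*-algebra generated by the direct sum of all representations, inside the
`ℓ^∞`-product of the algebras of bounded operators. -/

/-- The `ℓ^∞`-product of a family of nonzero unital C*-algebras. -/
def BoundedProd {I : Type*} (A : I → Type*) [∀ i, CStarAlgebra (A i)] : Type _ := lp A ∞

section BoundedProd

variable {I : Type*} {A : I → Type*} [∀ i, CStarAlgebra (A i)]

instance [∀ i, Nontrivial (A i)] : CStarAlgebra (BoundedProd A) :=
  letI : CStarAlgebra (lp A ∞) := { }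
  inferInstanceAs (CStarAlgebra (lp A ∞))

/-- The coordinates of an element of the product. -/
def BoundedProd.coord (a : BoundedProd A) : ∀ i, A i := a.1

theorem BoundedProd.ext {a b : BoundedProd A} (h : ∀ i, a.coord i = b.coord i) : a = b :=
  Subtype.ext (funext h)

/-- The element of the product with the given bounded family of coordinates. -/
def BoundedProd.mk (a : ∀ i, A i) (C : ℝ) (h : ∀ i, ‖a i‖ ≤ C) : BoundedProd A :=
  ⟨a, memℓp_infty ⟨C, by rintro _ ⟨i, rfl⟩; exact h i⟩⟩

theorem BoundedProd.norm_coord_le [∀ i, Nontrivial (A i)] (a : BoundedProd A) (i : I) :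
    ‖a.coord i‖ ≤ ‖a‖ :=
  lp.norm_apply_le_norm ENNReal.top_ne_zero (show lp A ∞ from a) i

/-- The *-homomorphism `(a_i)_i ↦ (a_{f(j)})_j` between products, for a map `f` of index sets. -/
def BoundedProd.reindex {J : Type*} [∀ i, Nontrivial (A i)] (f : J → I) :
    BoundedProd A →⋆ₐ[ℂ] BoundedProd (fun j => A (f j)) where
  toFun a := BoundedProd.mk (fun j => a.coord (f j)) ‖a‖ fun j => a.norm_coord_le (f j)
  map_one' := rfl
  map_mul' _ _ := rfl
  map_zero' := rfl
  map_add' _ _ := rfl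
  commutes' _ := rfl
  map_star' _ := rfl

end BoundedProd

section Generated

variable {A B : Type*} [CStarAlgebra A] [CStarAlgebra B]

/-- The (unital) C*-subalgebra of `A` generated by the set `X`. -/
def GeneratedCStar (X : Set A) : Type _ := (StarAlgebra.adjoin ℂ X).topologicalClosure

instance (X : Set A) : CStarAlgebra (GeneratedCStar X) :=
  have : IsClosed ((StarAlgebra.adjoin ℂ X).topologicalClosure : Set A) :=
    StarSubalgebra.isClosed_topologicalClosure _
  inferInstanceAs (CStarAlgebra (StarAlgebra.adjoin ℂ X).topologicalClosure)

/-- The inclusion of the generated C*-subalgebra. -/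
def GeneratedCStar.val (X : Set A) : GeneratedCStar X →⋆ₐ[ℂ] A :=
  (StarAlgebra.adjoin ℂ X).topologicalClosure.subtype

/-- A generator as an element of the generated C*-subalgebra. -/
def GeneratedCStar.of {X : Set A} (a : A) (ha : a ∈ X) : GeneratedCStar X :=
  ⟨a, StarSubalgebra.le_topologicalClosure _ (StarAlgebra.subset_adjoin ℂ _ ha)⟩

/-- Restriction of a *-homomorphism to generated C*-subalgebras. -/
def GeneratedCStar.map {X : Set A} {Y : Set B} (φ : A →⋆ₐ[ℂ] B) (h : ∀ a ∈ X, φ a ∈ Y) :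
    GeneratedCStar X →⋆ₐ[ℂ] GeneratedCStar Y :=
  (φ.comp (GeneratedCStar.val X)).codRestrict (StarAlgebra.adjoin ℂ Y).topologicalClosure fun a => by
    have h1 : StarAlgebra.adjoin ℂ X ≤ (StarAlgebra.adjoin ℂ Y).comap φ :=
      StarAlgebra.adjoin_le fun b hb => StarAlgebra.subset_adjoin ℂ _ (h b hb)
    have h2 : Continuous φ := AddMonoidHomClass.continuous_of_bound φ 1 fun x => by
      rw [one_mul]; exact NonUnitalStarAlgHom.norm_apply_le φ x
    exact map_mem_closure (f := φ) h2 a.2 fun b hb => h1 hb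

end Generated

section GroupoidAlgebra

variable (V : Type u) [Fintype V] [Groupoid.{u} V]

/-- The `ℓ^∞`-product of `B(H_π)` over all representations `π` of the groupoid. -/
abbrev GroupoidAmbient : Type (u + 1) := BoundedProd (fun π : GroupoidRep V => π.H →L[ℂ] π.H)

variable {V}

/-- The element `(π(g))_π` -/
def ambientU {x y : V} (g : x ⟶ y) : GroupoidAmbient V :=
  BoundedProd.mk (fun π => π.v g) 1 fun π => π.norm_v_le g

variable (V)

/-- The elements `(π(g))_π`, for `g` in the groupoid. -/
def groupoidGenerators : Set (GroupoidAmbient V) := {a | ∃ (x y : V) (g : x ⟶ y), a = ambientU g}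

/-- The full groupoid C*-algebra `C^*(𝒢)`. -/
abbrev GroupoidCStar : Type (u + 1) := GeneratedCStar (groupoidGenerators V)

variable {V}

/-- The generator `u_g = δ_g` of `C^*(𝒢)`. -/
def GroupoidCStar.u {x y : V} (g : x ⟶ y) : GroupoidCStar V :=
  GeneratedCStar.of (ambientU g) ⟨x, y, g, rfl⟩

end GroupoidAlgebra

section ToeplitzAlgebra

variable {V E₁ : Type u} [Fintype V] [Fintype E₁] [Groupoid.{u} V]
  {E : DirectedGraph V E₁} (S : SelfSimilarAction E)

/-- The `ℓ^∞`-product of `B(H_ρ)` over all Toeplitz representations `ρ`. -/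
abbrev ToeplitzAmbient : Type (u + 1) := BoundedProd (fun ρ : ToeplitzRep S => ρ.H →L[ℂ] ρ.H)

/-- The element `(v_g)_ρ` -/
def toeplitzAmbientU {x y : V} (g : x ⟶ y) : ToeplitzAmbient S :=
  BoundedProd.mk (fun ρ => ρ.v g) 1 fun ρ => ρ.norm_v_le g

/-- The element `(t_e)_ρ` -/
def toeplitzAmbientS (e : E₁) : ToeplitzAmbient S :=
  BoundedProd.mk (fun ρ => ρ.t e) 1 fun ρ => ρ.norm_t_le e

/-- The elements `(v_g)_ρ` and `(t_e)_ρ`. -/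
def toeplitzGenerators : Set (ToeplitzAmbient S) :=
  {a | ∃ (x y : V) (g : x ⟶ y), a = toeplitzAmbientU S g} ∪ Set.range (toeplitzAmbientS S)

/-- The Toeplitz algebra `𝒯(𝒢, E)`, generated by the universal Toeplitz representation
`(u, p, s)`. -/
abbrev ToeplitzAlgebra : Type (u + 1) := GeneratedCStar (toeplitzGenerators S)

namespace ToeplitzAlgebra

/-- The generator `u_g` of the Toeplitz algebra. -/
def u {x y : V} (g : x ⟶ y) : ToeplitzAlgebra S :=
  GeneratedCStar.of (toeplitzAmbientU S g) (Or.inl ⟨x, y, g, rfl⟩)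

/-- The generator `p_w = u_w` of the Toeplitz algebra. -/
def p (w : V) : ToeplitzAlgebra S := u S (𝟙 w)

/-- The generator `s_e` of the Toeplitz algebra. -/
def s (e : E₁) : ToeplitzAlgebra S :=
  GeneratedCStar.of (toeplitzAmbientS S e) (Or.inr ⟨e, rfl⟩)

/-- The element `s_{e₁} ⋯ s_{eₙ} p_{s(eₙ)}`, and `p_w` for the empty list at `w`. -/
def sList : V → List E₁ → ToeplitzAlgebra S
  | w, [] => p S w
  | _, e :: l => s S e * sList (E.s e) l

/-- `s_μ = s_{e₁} ⋯ s_{eₙ}` for a path `μ = e₁ ⋯ eₙ`, and `s_w = p_w` for a vertex `w`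
(note that `s_{eₙ} p_{s(eₙ)} = s_{eₙ}`). -/
def sPath {w : V} (μ : E.Path w) : ToeplitzAlgebra S := sList S w μ.1

end ToeplitzAlgebra

/-- The canonical *-homomorphism `C^*(𝒢) → 𝒯(𝒢, E)`, `u_g ↦ u_g`, through which `C^*(𝒢)` is
regarded as a subalgebra of `𝒯(𝒢, E)`; it sends `(a_π)_π` to `(a_{ρ|𝒢})_ρ`. -/
def incl : GroupoidCStar V →⋆ₐ[ℂ] ToeplitzAlgebra S :=
  GeneratedCStar.map (X := groupoidGenerators V) (Y := toeplitzGenerators S)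
    (BoundedProd.reindex (fun ρ : ToeplitzRep S => ρ.toGroupoidRep)) <| by
      rintro _ ⟨x, y, g, rfl⟩
      exact Or.inl ⟨x, y, g, rfl⟩

theorem incl_u {x y : V} (g : x ⟶ y) :
    incl S (GroupoidCStar.u g) = ToeplitzAlgebra.u S g := rfl

end ToeplitzAlgebra

/-! ## States and traces -/

open scoped ComplexOrder in
/-- A state of a unital C*-algebra. -/
structure CState (A : Type*) [CStarAlgebra A] where
  toLinearMap : A →ₗ[ℂ] ℂ
  nonneg : ∀ a : A, 0 ≤ toLinearMap (star a * a)
  map_one : toLinearMap 1 = 1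

instance (A : Type*) [CStarAlgebra A] : CoeFun (CState A) (fun _ => A → ℂ) :=
  ⟨fun φ => φ.toLinearMap⟩

/-- A tracial state (normalised trace) of a unital C*-algebra. -/
structure TracialState (A : Type*) [CStarAlgebra A] extends CState A where
  tracial : ∀ a b : A, toLinearMap (a * b) = toLinearMap (b * a)

instance (A : Type*) [CStarAlgebra A] : CoeFun (TracialState A) (fun _ => A → ℂ) :=
  ⟨fun φ => φ.toLinearMap⟩

section Main

variable {V E₁ : Type u} [Fintype V] [Fintype E₁] [Groupoid.{u} V] {E : DirectedGraph V E₁}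

/-- The vector `x^τ = (τ(u_v))_v` (the numbers `τ(u_v)` are real, see `coe_vertexVector`). -/
def vertexVector (τ : TracialState (GroupoidCStar V)) : V → ℝ :=
  fun v => (τ (GroupoidCStar.u (𝟙 v))).re

open scoped ComplexOrder in
theorem coe_vertexVector (τ : TracialState (GroupoidCStar V)) (v : V) :
    (vertexVector τ v : ℂ) = τ (GroupoidCStar.u (𝟙 v)) := by
  have h : star (GroupoidCStar.u (𝟙 v)) * GroupoidCStar.u (𝟙 v) = GroupoidCStar.u (𝟙 v) :=
    Subtype.ext (BoundedProd.ext fun π => π.star_v_mul_v (𝟙 v))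
  have h' := τ.nonneg (GroupoidCStar.u (𝟙 v))
  rw [h] at h'
  exact Complex.ext rfl (Complex.le_def.1 h').2

variable (E) in
/-- The `k`-th term `e^{-βk} ∑_{μ ∈ E^k} τ(u_{s(μ)})` of the series `Z(β,τ)`. -/
def partitionTerm (β : ℝ) (τ : TracialState (GroupoidCStar V)) (k : ℕ) : ℝ :=
  Real.exp (-(β * k)) * ∑ v : V, ∑ μ : E.PathN v k, vertexVector τ μ.1.source

variable (E) in
/-- `Z(β,τ) = ∑_k e^{-βk} ∑_{μ ∈ E^k} τ(u_{s(μ)})`. -/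
def partitionFunction (β : ℝ) (τ : TracialState (GroupoidCStar V)) : ℝ :=
  ∑' k, partitionTerm E β τ k

open Classical in
/-- The term `e^{-βk} ∑_{λ ∈ vE^k, g·λ = λ} τ(u_{g|_λ})`, for `g` with `d(g) = t(g) = v`. -/
def fixedTerm (S : SelfSimilarAction E) (β : ℝ) (τ : TracialState (GroupoidCStar V))
    {v : V} (g : v ⟶ v) (k : ℕ) : ℂ :=
  (Real.exp (-(β * k)) : ℂ) *
    ∑ l : E.PathN v k with S.act g l.1 = l.1, τ (GroupoidCStar.u (S.restr g l.1))

/-- `Ψ` is the state `Ψ_{β,τ}` of the Toeplitz algebra: for all `μ, ν ∈ E^*` and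
`g ∈ 𝒢^{s(μ)}_{s(ν)}`,
`Ψ(s_μ u_g s_ν^*) = δ_{μ,ν} e^{-β|μ|} Z(β,τ)⁻¹ ∑_k e^{-βk} ∑_{λ ∈ s(μ)E^k, g·λ=λ} τ(u_{g|_λ})`,
with convergent series. -/
structure IsPsi (S : SelfSimilarAction E) (β : ℝ) (τ : TracialState (GroupoidCStar V))
    (Ψ : CState (ToeplitzAlgebra S)) : Prop where
  summable : ∀ {v : V} (g : v ⟶ v), Summable (fixedTerm S β τ g)
  diag : ∀ {w : V} (μ : E.Path w) (g : μ.source ⟶ μ.source),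
    Ψ (ToeplitzAlgebra.sPath S μ * ToeplitzAlgebra.u S g * star (ToeplitzAlgebra.sPath S μ)) =
      (Real.exp (-(β * μ.length)) : ℂ) * (partitionFunction E β τ : ℂ)⁻¹ *
        ∑' k, fixedTerm S β τ g k
  offDiag : ∀ {w w' : V} (μ : E.Path w) (ν : E.Path w') (g : ν.source ⟶ μ.source),
    (⟨w, μ⟩ : Σ v, E.Path v) ≠ ⟨w', ν⟩ →
      Ψ (ToeplitzAlgebra.sPath S μ * ToeplitzAlgebra.u S g *
        star (ToeplitzAlgebra.sPath S ν)) = 0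

/-- `χ` is the map `τ ↦ Ψ_{β,τ}|_{C^*(𝒢)}` on the tracial states of `C^*(𝒢)`. -/
def IsChi (S : SelfSimilarAction E) (β : ℝ)
    (χ : TracialState (GroupoidCStar V) → TracialState (GroupoidCStar V)) : Prop :=
  ∀ τ, ∃ Ψ : CState (ToeplitzAlgebra S), IsPsi S β τ Ψ ∧ ∀ a, χ τ a = Ψ (incl S a)

end Main

/-- `‖y‖₁` -/
def l1Norm {V : Type u} [Fintype V] (y : V → ℝ) : ℝ := ∑ v, |y v|

/-- `I - e^{-β} A_E` -/
def oneSubExpAdj {V E₁ : Type u} [DecidableEq V] [Fintype E₁] (E : DirectedGraph V E₁) (β : ℝ) :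
    Matrix V V ℝ :=
  1 - Real.exp (-β) • E.adjMatrix.map (Int.cast : ℤ → ℝ)

/-- `A_vN = (I - e^{-β} A_E)⁻¹` -/
def vonNeumannMatrix {V E₁ : Type u} [Fintype V] [DecidableEq V] [Fintype E₁]
    (E : DirectedGraph V E₁) (β : ℝ) : Matrix V V ℝ :=
  (oneSubExpAdj E β)⁻¹

end SelfSim

end

/-! The analytic part is a Neumann series. Since β > log ρ(A_E), Gelfand's formula bounds the
entries of e^{-βk}A_E^k by a convergent geometric series for large k, so these matrices sum to A_vN
(`summable_expAdj_pow`, `hasSum_expAdj_pow`). Powers of A_E count paths (`sum_pathN_source`), so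
Z(β,τ) is the sum of the coordinates of A_vN x^τ. Its terms are nonnegative and the term k = 0
equals 1, hence Z > 0.

For the existence of Ψ, a state φ of C^*(𝒢) is induced to a Fock space spanned by vectors (μ,h) with
t(h) = s(μ) and Gram matrix δ_{μ,ν} φ(u_h^* u_k): one copy of u_{s(μ)}H_φ for each path μ, where H_φ
is the GNS space. An edge is prepended to the path, and g sends (μ,h) to (g·μ, g|_μ h); this is a
Toeplitz representation (`fockRep`). The vector functional at (l,1) kills s_μ u_g s_ν^* if μ ≠ ν. If
μ = ν, it is nonzero only if l = μλ with g·λ = λ, and then its value is φ(u_{g|_λ}). For φ = τ,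
summing these functionals over all l with weight e^{-β|l|} and dividing by Z gives Ψ (`psiState`,
`isPsi_psiState`); the series at a is dominated by ‖a‖ times that of Z (`psiTerm_norm_le`).
Uniqueness holds because states are continuous and the s_μ u_g s_ν^* span a dense subspace
(`dense_span_monomials`).

The restriction of Ψ to C^*(𝒢) is tracial: l ↦ g·l matches the fixed paths of hg with those of gh,
and the restrictions at matching paths are the two products of the same pair of elements, on which τ
agrees (`fixedTerm_comm`). A unit fixes every path, so the value of Ψ at u_v is Z⁻¹(A_vN x^τ)_v, and
Z is the 1-norm of the nonnegative vector A_vN x^τ. The formula for χ_β^n then follows by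
homogeneity (`vertexVector_iterate`). -/

noncomputable section

namespace SelfSim

/-! ## The Hilbert space of a positive semidefinite kernel -/

/-- A positive semidefinite kernel on a set. -/
structure PosKernel (I : Type u) where
  K : I → I → ℂ
  conj_symm : ∀ i j, (starRingEnd ℂ) (K j i) = K i j
  nonneg : ∀ x : I →₀ ℂ,
    0 ≤ (x.sum fun i a => x.sum fun j b => (starRingEnd ℂ) a * b * K i j).re

namespace PosKernel

variable {I : Type u} (κ : PosKernel I)

/-- The finitely supported functions, carrying the semi-inner product given by the kernel. -/
def Pre (_ : PosKernel I) : Type u := I →₀ ℂ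

instance : AddCommGroup κ.Pre := inferInstanceAs (AddCommGroup (I →₀ ℂ))
instance : Module ℂ κ.Pre := inferInstanceAs (Module ℂ (I →₀ ℂ))

/-- The sesquilinear form of a kernel. -/
def form (x y : I →₀ ℂ) : ℂ := x.sum fun i a => y.sum fun j b => (starRingEnd ℂ) a * b * κ.K i j

theorem form_add_left (x y z : I →₀ ℂ) : κ.form (x + y) z = κ.form x z + κ.form y z := by
  unfold form
  rw [Finsupp.sum_add_index']
  · intro i; simp
  · intro i a b
    simp [add_mul, Finsupp.sum_add]

theorem form_smul_left (x y : I →₀ ℂ) (c : ℂ) :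
    κ.form (c • x) y = (starRingEnd ℂ) c * κ.form x y := by
  unfold form
  rw [Finsupp.sum_smul_index' (by intro i; simp)]
  simp [Finsupp.mul_sum, mul_assoc]

theorem conj_form (x y : I →₀ ℂ) : (starRingEnd ℂ) (κ.form y x) = κ.form x y := by
  unfold form Finsupp.sum
  rw [Finset.sum_comm, map_sum]
  refine Finset.sum_congr rfl fun i _ => ?_
  rw [map_sum]
  refine Finset.sum_congr rfl fun j _ => ?_
  rw [map_mul, map_mul, κ.conj_symm, Complex.conj_conj]
  ring

theorem form_single (i j : I) (a b : ℂ) :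
    κ.form (Finsupp.single i a) (Finsupp.single j b) = (starRingEnd ℂ) a * b * κ.K i j := by
  simp [form]

/-- The semi-inner product space structure given by the kernel. -/
abbrev core : PreInnerProductSpace.Core ℂ κ.Pre where
  inner := κ.form
  conj_inner_symm x y := κ.conj_form x y
  re_inner_nonneg := κ.nonneg
  add_left := κ.form_add_left
  smul_left := κ.form_smul_left

instance : SeminormedAddCommGroup κ.Pre :=
  InnerProductSpace.Core.toSeminormedAddCommGroup (c := κ.core)
instance : InnerProductSpace ℂ κ.Pre := InnerProductSpace.ofCore κ.core

/-- The Hilbert space of the kernel. -/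
abbrev Hilb : Type u := UniformSpace.Completion κ.Pre

/-- The basis vectors of the space of finitely supported functions. -/
def preBasis (i : I) : κ.Pre := (Finsupp.single i 1 : I →₀ ℂ)

theorem inner_preBasis (i j : I) : inner ℂ (κ.preBasis i) (κ.preBasis j) = κ.K i j := by
  change κ.form _ _ = _
  simp [preBasis, form_single]

theorem span_preBasis : Submodule.span ℂ (Set.range κ.preBasis) = ⊤ := by
  have h := (Finsupp.basisSingleOne (R := ℂ) (ι := I)).span_eq
  rw [Finsupp.coe_basisSingleOne] at h
  exact h

/-- The canonical vectors, with Gram matrix the kernel. -/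
def vec (i : I) : κ.Hilb := (κ.preBasis i : κ.Pre)

theorem inner_vec (i j : I) : inner ℂ (κ.vec i) (κ.vec j) = κ.K i j := by
  rw [vec, vec, UniformSpace.Completion.inner_coe, inner_preBasis]

/-- The canonical vectors span a dense subspace. All operator identities in the Fock representation
are checked on them. -/
theorem clm_ext {T T' : κ.Hilb →L[ℂ] κ.Hilb} (h : ∀ i, T (κ.vec i) = T' (κ.vec i)) : T = T' := by
  refine ContinuousLinearMap.ext fun x => ?_
  induction x using UniformSpace.Completion.induction_on with
  | hp => exact isClosed_eq T.continuous T'.continuous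
  | ih x =>
    have hx : x ∈ Submodule.span ℂ (Set.range κ.preBasis) := by rw [span_preBasis]; trivial
    induction hx using Submodule.span_induction with
    | mem x hx => obtain ⟨i, rfl⟩ := hx; exact h i
    | zero =>
      have h0 : ((0 : κ.Pre) : κ.Hilb) = 0 := UniformSpace.Completion.coe_zero
      rw [h0, map_zero, map_zero]
    | add x y _ _ hx hy => rw [UniformSpace.Completion.coe_add, map_add, map_add, hx, hy]
    | smul a x _ hx => rw [UniformSpace.Completion.coe_smul, map_smul, map_smul, hx]

/-- The kernel makes the partial bijection `f` adjoint to its inverse. -/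
def Admissible (f : I ≃. I) : Prop :=
  ∀ i j, (f i).elim 0 (fun i' => κ.K i' j) = (f.symm j).elim 0 (fun j' => κ.K i j')

/-- The linear map of finitely supported functions given by a partial bijection. -/
def preOp (f : I ≃. I) : κ.Pre →ₗ[ℂ] κ.Pre :=
  Finsupp.linearCombination (M := κ.Pre) ℂ fun i => (f i).elim (0 : κ.Pre) κ.preBasis

theorem preOp_preBasis (f : I ≃. I) (i : I) :
    κ.preOp f (κ.preBasis i) = (f i).elim 0 κ.preBasis := by
  unfold preOp preBasis
  erw [Finsupp.linearCombination_single]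
  rw [one_smul]

theorem preLinearMap_ext {M : Type*} [AddCommGroup M] [Module ℂ M] {T T' : κ.Pre →ₗ[ℂ] M}
    (h : ∀ i, T (κ.preBasis i) = T' (κ.preBasis i)) : T = T' :=
  LinearMap.ext_on_range κ.span_preBasis h

theorem preOp_trans (f g : I ≃. I) (x : κ.Pre) :
    κ.preOp g (κ.preOp f x) = κ.preOp (f.trans g) x := by
  have : κ.preOp g ∘ₗ κ.preOp f = κ.preOp (f.trans g) := by
    refine κ.preLinearMap_ext fun i => ?_
    rw [LinearMap.comp_apply, preOp_preBasis, preOp_preBasis]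
    change _ = ((f i).bind g).elim _ _
    cases f i with
    | none => simp
    | some j => simp [preOp_preBasis]
  exact LinearMap.congr_fun this x

variable {κ}

theorem Admissible.symm {f : I ≃. I} (h : κ.Admissible f) : κ.Admissible f.symm := by
  intro i j
  have := congrArg (starRingEnd ℂ) (h j i)
  rw [PEquiv.symm_symm]
  cases h1 : f j <;> cases h2 : f.symm i <;> simp_all [κ.conj_symm]

theorem Admissible.inner_preOp {f : I ≃. I} (h : κ.Admissible f) (x y : κ.Pre) :
    inner ℂ (κ.preOp f x) y = inner ℂ x (κ.preOp f.symm y) := by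
  have hx : x ∈ Submodule.span ℂ (Set.range κ.preBasis) := by rw [span_preBasis]; trivial
  induction hx using Submodule.span_induction with
  | mem x hx =>
    obtain ⟨i, rfl⟩ := hx
    have hy : y ∈ Submodule.span ℂ (Set.range κ.preBasis) := by rw [span_preBasis]; trivial
    induction hy using Submodule.span_induction with
    | mem y hy =>
      obtain ⟨j, rfl⟩ := hy
      have := h i j
      rw [preOp_preBasis, preOp_preBasis]
      cases h1 : f i <;> cases h2 : f.symm j <;> simp_all [inner_preBasis]
    | zero => simp
    | add x y _ _ hx hy => rw [map_add, inner_add_right, inner_add_right, hx, hy]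
    | smul a x _ hx => rw [map_smul, inner_smul_right, inner_smul_right, hx]
  | zero => simp
  | add x y _ _ hx hy => rw [map_add, inner_add_left, inner_add_left, hx, hy]
  | smul a x _ hx => rw [map_smul, inner_smul_left, inner_smul_left, hx]

/-- Write T for the operator of f and T* for that of its inverse. From f f⁻¹ f = f one gets ‖T*Tx‖ =
‖Tx‖, and Cauchy–Schwarz gives ‖Tx‖² = ⟨x, T*Tx⟩ ≤ ‖x‖‖Tx‖. Boundedness thus needs only adjointness,
although the kernel may be degenerate. -/
theorem Admissible.norm_preOp_le {f : I ≃. I} (h : κ.Admissible f) (x : κ.Pre) :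
    ‖κ.preOp f x‖ ≤ ‖x‖ := by
  have key : ∀ y : κ.Pre, ‖κ.preOp f y‖ ^ 2 = (inner ℂ y (κ.preOp (f.trans f.symm) y)).re := by
    intro y
    rw [← preOp_trans, ← h.inner_preOp, ← RCLike.re_to_complex, inner_self_eq_norm_sq]
  have h2 : ‖κ.preOp (f.trans f.symm) x‖ ^ 2 = ‖κ.preOp f x‖ ^ 2 := by
    have h3 : (f.trans f.symm).trans f = f := by
      refine PEquiv.ext fun i => ?_
      cases hi : f i with
      | none => simp [PEquiv.trans, hi]
      | some j =>
        have : f.symm j = some i := (PEquiv.eq_some_iff f).2 hi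
        change ((f i).bind f.symm).bind f = _
        simp [hi, this]
    rw [← @inner_self_eq_norm_sq ℂ, ← preOp_trans, h.symm.inner_preOp, PEquiv.symm_symm,
      preOp_trans, preOp_trans, ← PEquiv.trans_assoc, h3, inner_self_eq_norm_sq]
  have h4 : ‖κ.preOp f x‖ ^ 2 ≤ ‖x‖ * ‖κ.preOp (f.trans f.symm) x‖ := by
    rw [key]
    exact (Complex.re_le_norm _).trans (norm_inner_le_norm _ _)
  have h5 : ‖κ.preOp (f.trans f.symm) x‖ = ‖κ.preOp f x‖ :=
    (sq_eq_sq₀ (norm_nonneg _) (norm_nonneg _)).1 h2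
  rw [h5] at h4
  nlinarith [norm_nonneg (κ.preOp f x), norm_nonneg x]

variable (κ) in
open Classical in
/-- The partial isometry on the Hilbert space given by an admissible partial bijection. -/
def op (f : I ≃. I) : κ.Hilb →L[ℂ] κ.Hilb :=
  if h : κ.Admissible f then
    ((κ.preOp f).mkContinuous 1 fun x => by rw [one_mul]; exact h.norm_preOp_le x).completion
  else 0

theorem op_vec {f : I ≃. I} (h : κ.Admissible f) (i : I) :
    κ.op f (κ.vec i) = (f i).elim 0 κ.vec := by
  rw [op, dif_pos h, vec, ContinuousLinearMap.completion_apply_coe, LinearMap.mkContinuous_apply,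
    preOp_preBasis]
  cases f i with
  | none => exact UniformSpace.Completion.coe_zero
  | some j => rfl

theorem star_op {f : I ≃. I} (h : κ.Admissible f) : star (κ.op f) = κ.op f.symm := by
  rw [ContinuousLinearMap.star_eq_adjoint]
  symm
  refine (ContinuousLinearMap.eq_adjoint_iff _ _).2 fun x y => ?_
  induction x, y using UniformSpace.Completion.induction_on₂ with
  | hp => apply isClosed_eq <;> fun_prop
  | ih x y =>
    rw [op, op, dif_pos h, dif_pos h.symm]
    simp [h.symm.inner_preOp]

theorem Admissible.trans {f g : I ≃. I} (hf : κ.Admissible f) (hg : κ.Admissible g) :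
    κ.Admissible (f.trans g) := by
  intro i j
  have e1 : (f.trans g) i = (f i).bind g := rfl
  have e2 : (f.trans g).symm j = (g.symm j).bind f.symm := by rw [PEquiv.symm_trans_rev]; rfl
  rw [e1, e2]
  have h1 := fun i' => hg i' j
  have h2 := hf i
  cases hi : f i with
  | none =>
    cases hj : g.symm j with
    | none => rfl
    | some j' => have := h2 j'; rw [hi] at this; simpa using this
  | some i' =>
    have h1 := h1 i'
    cases hj : g.symm j with
    | none => rw [hj] at h1; simpa using h1
    | some j' =>
      have := h2 j'; rw [hi] at this; rw [hj] at h1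
      simp only [Option.bind_some, Option.elim_some] at *
      rw [h1, this]

theorem op_mul_op {f g : I ≃. I} (hf : κ.Admissible f) (hg : κ.Admissible g) :
    κ.op g * κ.op f = κ.op (f.trans g) := by
  refine κ.clm_ext fun i => ?_
  rw [mul_apply_eq_comp, op_vec hf, op_vec (hf.trans hg)]
  change _ = ((f i).bind g).elim _ _
  cases f i <;> simp [op_vec hg]

theorem op_bot : κ.op ⊥ = 0 := by
  refine κ.clm_ext fun i => ?_
  rw [op_vec (by intro i j; rfl)]
  rfl

end PosKernel

/-! ### Continuity of states and a density criterion for generated C*-algebras -/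

open scoped ComplexOrder in
theorem CState.continuous {A : Type*} [CStarAlgebra A] (φ : CState A) :
    Continuous φ.toLinearMap := by
  let _ : PartialOrder A := CStarAlgebra.spectralOrder A
  have : StarOrderedRing A := CStarAlgebra.spectralOrderedRing A
  have h : ∀ a : A, 0 ≤ a → 0 ≤ φ.toLinearMap a := by
    intro a ha
    obtain ⟨b, rfl⟩ := CStarAlgebra.nonneg_iff_eq_star_mul_self.1 ha
    exact φ.nonneg b
  exact map_continuous (PositiveLinearMap.mk₀ φ.toLinearMap h)

theorem CState.ext {A : Type*} [CStarAlgebra A] {φ ψ : CState A} (h : ∀ a, φ a = ψ a) :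
    φ = ψ := by
  cases φ; cases ψ
  congr
  exact LinearMap.ext h

theorem TracialState.ext {A : Type*} [CStarAlgebra A] {φ ψ : TracialState A}
    (h : ∀ a, φ a = ψ a) : φ = ψ := by
  have := CState.ext (φ := φ.toCState) (ψ := ψ.toCState) h
  cases φ; cases ψ
  congr

/-- An element of the star algebra generated by `X`, in the generated C*-algebra. -/
def GeneratedCStar.ofAdjoin {A : Type*} [CStarAlgebra A] {X : Set A} {a : A}
    (ha : a ∈ StarAlgebra.adjoin ℂ X) : GeneratedCStar X :=
  ⟨a, StarSubalgebra.le_topologicalClosure _ ha⟩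

/-- A submodule of a generated C*-algebra that contains `1` and is stable under left
multiplication by the generators and their adjoints is dense. -/
theorem GeneratedCStar.dense_of_mul_mem {A : Type*} [CStarAlgebra A] {X : Set A}
    (M : Submodule ℂ (GeneratedCStar X)) (one : (1 : GeneratedCStar X) ∈ M)
    (mul : ∀ (a : A) (ha : a ∈ X), ∀ m ∈ M, GeneratedCStar.of a ha * m ∈ M)
    (star_mul : ∀ (a : A) (ha : a ∈ X), ∀ m ∈ M, star (GeneratedCStar.of a ha) * m ∈ M) :
    Dense (M : Set (GeneratedCStar X)) := by
  -- The claim is carried for an element and its adjoint together, so that the induction passes the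
  -- star step.
  have key : ∀ a (ha : a ∈ StarAlgebra.adjoin ℂ X),
      (∀ m ∈ M, GeneratedCStar.ofAdjoin ha * m ∈ M) ∧
      ∀ m ∈ M,
        star (GeneratedCStar.ofAdjoin ha) * m ∈ M := by
    intro a ha
    induction ha using StarAlgebra.adjoin_induction with
    | mem a ha => exact ⟨mul a ha, star_mul a ha⟩
    | algebraMap c =>
      refine ⟨fun m hm => ?_, fun m hm => ?_⟩
      · have := M.smul_mem c hm
        rw [← one_mul m, ← smul_mul_assoc, ← Algebra.algebraMap_eq_smul_one] at this
        exact this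
      · have := M.smul_mem (star c) hm
        rw [← one_mul m, ← smul_mul_assoc, ← Algebra.algebraMap_eq_smul_one,
          algebraMap_star_comm] at this
        exact this
    | add a b ha hb ha' hb' =>
      refine ⟨fun m hm => ?_, fun m hm => ?_⟩
      · have := M.add_mem (ha'.1 m hm) (hb'.1 m hm)
        rw [← add_mul] at this
        exact this
      · have := M.add_mem (ha'.2 m hm) (hb'.2 m hm)
        rw [← add_mul, ← star_add] at this
        exact this
    | mul a b ha hb ha' hb' =>
      refine ⟨fun m hm => ?_, fun m hm => ?_⟩
      · have := ha'.1 _ (hb'.1 m hm)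
        rw [← mul_assoc] at this
        exact this
      · have := hb'.2 _ (ha'.2 m hm)
        rw [← mul_assoc, ← StarMul.star_mul] at this
        exact this
    | star a ha ha' =>
      refine ⟨ha'.2, fun m hm => ?_⟩
      have := ha'.1 m hm
      rw [← star_star (GeneratedCStar.ofAdjoin ha)] at this
      exact this
  intro a
  have h1 : ∀ b ∈ (StarAlgebra.adjoin ℂ X : Set A), ∃ m ∈ M, GeneratedCStar.val X m = b := by
    intro b hb
    refine ⟨_, (key b hb).1 1 one, ?_⟩
    rw [mul_one]; rfl
  have h2 : Topology.IsEmbedding (GeneratedCStar.val X) := Topology.IsEmbedding.subtypeVal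
  rw [h2.isInducing.closure_eq_preimage_closure_image]
  exact closure_mono (fun b hb => h1 b hb) a.2

/-- The canonical projection of a product onto one of its factors. -/
def BoundedProd.proj {I : Type*} {A : I → Type*} [∀ i, CStarAlgebra (A i)]
    [∀ i, Nontrivial (A i)] (i : I) : BoundedProd A →⋆ₐ[ℂ] A i where
  toFun a := a.coord i
  map_one' := rfl
  map_mul' _ _ := rfl
  map_zero' := rfl
  map_add' _ _ := rfl
  commutes' _ := rfl
  map_star' _ := rfl

/-! ### Relations and dense span in the groupoid C*-algebra -/

namespace GroupoidCStar

variable {V : Type u} [Fintype V] [Groupoid.{u} V]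

/-- The evaluation of the groupoid algebra at a representation. -/
def eval (π : GroupoidRep V) : GroupoidCStar V →⋆ₐ[ℂ] (π.H →L[ℂ] π.H) :=
  (BoundedProd.proj π).comp (GeneratedCStar.val _)

theorem ext_eval {a b : GroupoidCStar V} (h : ∀ π, eval π a = eval π b) : a = b :=
  Subtype.ext (BoundedProd.ext h)

theorem u_mul {x y z : V} (h : x ⟶ y) (g : y ⟶ z) : u g * u h = u (h ≫ g) :=
  ext_eval fun π => by rw [map_mul]; exact π.v_mul h g

theorem u_mul_eq_zero {x y y' z : V} (h : x ⟶ y) (g : y' ⟶ z) (hy : y' ≠ y) :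
    u g * u h = 0 :=
  ext_eval fun π => by rw [map_mul, map_zero]; exact π.v_mul_eq_zero h g hy

theorem star_u {x y : V} (g : x ⟶ y) : star (u g) = u (Groupoid.inv g) :=
  ext_eval fun π => by rw [map_star]; exact (π.v_inv g).symm

theorem sum_u : ∑ w : V, u (𝟙 w) = 1 :=
  ext_eval fun π => by rw [map_sum, map_one]; exact π.sum_v

theorem dense_span :
    Dense (Submodule.span ℂ {a : GroupoidCStar V | ∃ (x y : V) (g : x ⟶ y), a = u g} :
      Set (GroupoidCStar V)) := by
  have hmul : ∀ (x y : V) (g : x ⟶ y),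
      ∀ m ∈ Submodule.span ℂ {a : GroupoidCStar V | ∃ (x y : V) (g : x ⟶ y), a = u g},
      u g * m ∈ Submodule.span ℂ {a : GroupoidCStar V | ∃ (x y : V) (g : x ⟶ y), a = u g} := by
    intro x y g m hm
    induction hm using Submodule.span_induction with
    | mem m hm =>
      obtain ⟨x', y', h, rfl⟩ := hm
      by_cases hy : x = y'
      · subst hy
        rw [u_mul]
        exact Submodule.subset_span ⟨_, _, _, rfl⟩
      · rw [u_mul_eq_zero _ _ hy]; exact Submodule.zero_mem _
    | zero => rw [mul_zero]; exact Submodule.zero_mem _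
    | add a b _ _ ha hb => rw [mul_add]; exact Submodule.add_mem _ ha hb
    | smul c a _ ha => rw [mul_smul_comm]; exact Submodule.smul_mem _ _ ha
  refine GeneratedCStar.dense_of_mul_mem _ ?_ ?_ ?_
  · rw [← sum_u]
    exact Submodule.sum_mem _ fun w _ => Submodule.subset_span ⟨_, _, _, rfl⟩
  · rintro _ ⟨x, y, g, rfl⟩ m hm
    exact hmul x y g m hm
  · rintro _ ⟨x, y, g, rfl⟩ m hm
    change star (u g) * m ∈ _
    rw [star_u]
    exact hmul y x _ m hm

/-- A state is tracial as soon as it is so on the generators. -/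
theorem tracial_of_generators (φ : CState (GroupoidCStar V))
    (h : ∀ {x y x' y' : V} (g : x ⟶ y) (g' : x' ⟶ y'), φ (u g * u g') = φ (u g' * u g)) :
    ∀ a b, φ (a * b) = φ (b * a) := by
  have hφ := φ.continuous
  -- Continuous functionals are determined by the u_g; this is applied once in each variable of the
  -- commutator.
  have key : ∀ (f f' : GroupoidCStar V →ₗ[ℂ] ℂ), Continuous f → Continuous f' →
      (∀ (x y : V) (g : x ⟶ y), f (u g) = f' (u g)) → ∀ a, f a = f' a := by
    intro f f' hf hf' hg a
    refine congrFun (hf.ext_on dense_span hf' (LinearMap.eqOn_span ?_)) a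
    rintro _ ⟨x, y, g, rfl⟩
    exact hg x y g
  intro a b
  refine key (φ.toLinearMap ∘ₗ LinearMap.mulRight ℂ b) (φ.toLinearMap ∘ₗ LinearMap.mulLeft ℂ b)
    (hφ.comp (continuous_mul_const b)) (hφ.comp (continuous_const_mul b)) (fun x y g => ?_) a
  exact key (φ.toLinearMap ∘ₗ LinearMap.mulLeft ℂ (u g))
    (φ.toLinearMap ∘ₗ LinearMap.mulRight ℂ (u g))
    (hφ.comp (continuous_const_mul _)) (hφ.comp (continuous_mul_const _))
    (fun x' y' g' => h g g') b

end GroupoidCStar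

/-! ### Growth of matrix powers -/

section Spectral

attribute [local instance] Matrix.linftyOpNormedRing Matrix.linftyOpNormedAlgebra

/-- The entry is a coordinate of M applied to a standard basis vector, which has sup norm at most 1.
-/
theorem norm_apply_le_linfty_opNorm {V : Type*} [Fintype V] [DecidableEq V] (M : Matrix V V ℂ)
    (v w : V) : ‖M v w‖ ≤ ‖M‖ := by
  have h := Matrix.linfty_opNorm_mulVec M (Pi.single w 1)
  have h1 : ‖(Pi.single w 1 : V → ℂ)‖ ≤ 1 := by
    refine (pi_norm_le_iff_of_nonneg zero_le_one).2 fun i => ?_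
    by_cases hi : i = w
    · subst hi; simp
    · simp [hi]
  have h2 := norm_le_pi_norm (M.mulVec (Pi.single w 1)) v
  rw [Matrix.mulVec_single_one, Matrix.col_apply] at h2
  rw [Matrix.mulVec_single_one] at h
  nlinarith [norm_nonneg M]

/-- The powers of a complex matrix grow slower than those of any number beyond the spectral
radius. -/
theorem summable_mul_norm_pow_apply {V : Type*} [Fintype V] [DecidableEq V] (M : Matrix V V ℂ)
    {c : ℝ} (hc : 0 < c) (h : spectralRadius ℂ M < ENNReal.ofReal c⁻¹) (v w : V) :
    Summable fun k : ℕ => c ^ k * ‖(M ^ k) v w‖ := by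
  -- Any q strictly between the spectral radius and c⁻¹ works: by Gelfand's formula ‖M^k‖ ≤ q^k
  -- eventually, and cq < 1.
  obtain ⟨q, hq1, hq2⟩ := ENNReal.lt_iff_exists_nnreal_btwn.1 h
  have hq : (q : ℝ) * c < 1 := by
    rw [ENNReal.ofReal, ENNReal.coe_lt_coe, ← NNReal.coe_lt_coe,
      Real.coe_toNNReal _ (inv_pos.2 hc).le] at hq2
    rwa [← lt_div_iff₀ hc, one_div]
  have hG := spectrum.pow_nnnorm_pow_one_div_tendsto_nhds_spectralRadius M
  have hev : ∀ᶠ k : ℕ in Filter.atTop, ‖c ^ k * ‖(M ^ k) v w‖‖ ≤ (c * q) ^ k := by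
    filter_upwards [hG.eventually (gt_mem_nhds hq1), Filter.eventually_gt_atTop 0] with k hk hk0
    have h1 : (‖M ^ k‖₊ : ℝ≥0∞) ≤ (q : ℝ≥0∞) ^ k := by
      rw [one_div] at hk
      have := ENNReal.rpow_le_rpow hk.le (Nat.cast_nonneg (α := ℝ) k)
      rwa [ENNReal.rpow_inv_rpow (by positivity), ENNReal.rpow_natCast] at this
    have h2 : ‖M ^ k‖ ≤ (q : ℝ) ^ k := by exact_mod_cast h1
    rw [norm_mul, norm_norm, norm_pow, Real.norm_of_nonneg hc.le, mul_pow]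
    gcongr
    exact (norm_apply_le_linfty_opNorm _ _ _).trans h2
  refine Summable.of_norm_bounded_eventually_nat (g := fun k => (c * q) ^ k) ?_ hev
  exact summable_geometric_of_lt_one (by positivity) (by rwa [mul_comm])

end Spectral

/-! ### The Neumann series of the adjacency matrix -/

section Adjacency

variable {V E₁ : Type u} [DecidableEq V] [Fintype E₁] {E : DirectedGraph V E₁}

variable (E) in
/-- The matrix `e^{-β} A_E`. -/
def expAdj (β : ℝ) : Matrix V V ℝ := Real.exp (-β) • E.adjMatrix.map (Int.cast : ℤ → ℝ)

variable [Fintype V]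

theorem summable_expAdj_pow {β : ℝ}
    (hβ : ENNReal.log (spectralRadius ℂ (E.adjMatrix.map (Int.cast : ℤ → ℂ))) < (β : EReal)) :
    Summable fun k : ℕ => expAdj E β ^ k := by
  -- Exponentiating the hypothesis gives ρ(A_E) < e^β. The extended logarithm covers ρ(A_E) = 0 as
  -- well.
  have hr : spectralRadius ℂ (E.adjMatrix.map (Int.cast : ℤ → ℂ)) <
      ENNReal.ofReal (Real.exp (-β))⁻¹ := by
    rw [← Real.exp_neg, neg_neg, ← ENNReal.log_lt_log_iff,
      ENNReal.log_ofReal_of_pos (Real.exp_pos β), Real.log_exp]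
    exact hβ
  refine Pi.summable.2 fun v => Pi.summable.2 fun w => Summable.of_norm ?_
  convert summable_mul_norm_pow_apply _ (Real.exp_pos (-β)) hr v w using 2 with k
  have h1 : (E.adjMatrix.map (Int.cast : ℤ → ℂ)) ^ k =
      ((E.adjMatrix.map (Int.cast : ℤ → ℝ)) ^ k).map (Complex.ofRealHom) := by
    rw [Matrix.map_pow]
    congr 1
  rw [h1, expAdj, smul_pow, Matrix.smul_apply, Matrix.map_apply, smul_eq_mul, norm_mul, norm_pow,
    Real.norm_of_nonneg (Real.exp_pos _).le]
  simp

theorem isUnit_oneSubExpAdj {β : ℝ}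
    (hβ : ENNReal.log (spectralRadius ℂ (E.adjMatrix.map (Int.cast : ℤ → ℂ))) < (β : EReal)) :
    IsUnit (oneSubExpAdj E β) :=
  IsUnit.of_mul_eq_one _ (summable_expAdj_pow hβ).one_sub_mul_tsum_pow

theorem hasSum_expAdj_pow {β : ℝ}
    (hβ : ENNReal.log (spectralRadius ℂ (E.adjMatrix.map (Int.cast : ℤ → ℂ))) < (β : EReal)) :
    HasSum (fun k : ℕ => expAdj E β ^ k) (vonNeumannMatrix E β) := by
  have h := (summable_expAdj_pow hβ).hasSum
  rwa [← Matrix.inv_eq_right_inv (summable_expAdj_pow hβ).one_sub_mul_tsum_pow] at h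

theorem hasSum_expAdj_pow_mulVec {β : ℝ}
    (hβ : ENNReal.log (spectralRadius ℂ (E.adjMatrix.map (Int.cast : ℤ → ℂ))) < (β : EReal))
    (x : V → ℝ) (v : V) :
    HasSum (fun k : ℕ => (expAdj E β ^ k).mulVec x v) ((vonNeumannMatrix E β).mulVec x v) := by
  unfold Matrix.mulVec dotProduct
  refine hasSum_sum fun w _ => HasSum.mul_right _ ?_
  exact Pi.hasSum.1 (Pi.hasSum.1 (hasSum_expAdj_pow hβ) v) w

end Adjacency

/-! ### Sums over paths of a given length -/

section PathSums

variable {V E₁ : Type u} [Fintype E₁] (E : DirectedGraph V E₁)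
variable {M : Type*} [AddCommMonoid M]

/-- Summands in this section are functions of the bare list of edges, so that inductions do not have
to transport proofs that a list is a path. -/
theorem sum_pathN_zero (v : V) (f : List E₁ → M) :
    ∑ μ : E.PathN v 0, f μ.1.1 = f [] := by
  let nil : E.PathN v 0 := ⟨⟨[], trivial⟩, rfl⟩
  refine Fintype.sum_eq_single nil ?_
  rintro ⟨⟨l, hl⟩, h⟩ hne
  exact absurd (Subtype.ext (Subtype.ext (List.length_eq_zero_iff.1 h))) hne

/-- A nonempty path splits into its first edge and the remaining path. -/
def pathNSuccEquiv (v : V) (k : ℕ) :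
    E.PathN v (k + 1) ≃ Σ e : {e : E₁ // E.r e = v}, E.PathN (E.s e.1) k where
  toFun
    | ⟨⟨[], _⟩, h⟩ => absurd h (Nat.succ_ne_zero k).symm
    | ⟨⟨e :: l, hl⟩, h⟩ => ⟨⟨e, hl.1⟩, ⟨⟨l, hl.2⟩, Nat.succ_injective h⟩⟩
  invFun p := ⟨⟨p.1.1 :: p.2.1.1, p.1.2, p.2.1.2⟩, congrArg Nat.succ p.2.2⟩
  left_inv := by
    rintro ⟨⟨_ | ⟨e, l⟩, hl⟩, h⟩
    · exact absurd h (Nat.succ_ne_zero k).symm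
    · rfl
  right_inv p := rfl

theorem sum_pathN_succ [DecidableEq V] (v : V) (k : ℕ) (f : List E₁ → M) :
    ∑ μ : E.PathN v (k + 1), f μ.1.1 =
      ∑ e : E₁ with E.r e = v, ∑ μ : E.PathN (E.s e) k, f (e :: μ.1.1) := by
  rw [← (pathNSuccEquiv E v k).symm.sum_comp, Fintype.sum_sigma, ← Finset.sum_subtype_eq_sum_filter]
  rw [Finset.subtype_univ]
  rfl

/-- A sum over paths whose terms vanish off the extensions of a given path `l`. -/
theorem sum_pathN_prefix (f : List E₁ → M) (l : List E₁) (v : V) (hl : E.IsPathFrom v l) (j : ℕ)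
    (hf : ∀ m : List E₁, ¬ l <+: m → f m = 0) :
    ∑ μ : E.PathN v (l.length + j), f μ.1.1 =
      ∑ μ : E.PathN (E.listSource v l) j, f (l ++ μ.1.1) := by
  classical
  induction l generalizing v f with
  | nil =>
    rw [List.length_nil, Nat.zero_add]
    rfl
  | cons e l ih =>
    rw [List.length_cons, Nat.add_right_comm, sum_pathN_succ, Finset.sum_eq_single e]
    · exact ih (fun m => f (e :: m)) (E.s e) hl.2 fun m hm => hf _ fun h => hm (by simpa using h)
    · intro e' _ hne
      refine Finset.sum_eq_zero fun μ _ => hf _ fun h => hne ?_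
      simp only [List.cons_prefix_cons] at h
      exact h.1.symm
    · intro h
      exact absurd (Finset.mem_filter.2 ⟨Finset.mem_univ e, hl.1⟩) h

/-- Splitting off the first edge multiplies by A_E on the left, once the edges with range v are
grouped by their source. -/
theorem sum_pathN_source [Fintype V] [DecidableEq V] (x : V → ℝ) (k : ℕ) (v : V) :
    ∑ μ : E.PathN v k, x μ.1.source =
      ((E.adjMatrix.map (Int.cast : ℤ → ℝ)) ^ k).mulVec x v := by
  induction k generalizing v with
  | zero =>
    rw [pow_zero, Matrix.one_mulVec]
    exact sum_pathN_zero E v fun l => x (E.listSource v l)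
  | succ k ih =>
    rw [pow_succ', ← Matrix.mulVec_mulVec]
    refine (sum_pathN_succ E v k fun l => x (E.listSource v l)).trans ?_
    have h1 : ∀ e : E₁, ∑ μ : E.PathN (E.s e) k, x (E.listSource v (e :: μ.1.1)) =
        ((E.adjMatrix.map (Int.cast : ℤ → ℝ)) ^ k).mulVec x (E.s e) := fun e => ih (E.s e)
    simp only [h1]
    generalize ((E.adjMatrix.map (Int.cast : ℤ → ℝ)) ^ k).mulVec x = y
    change _ = ∑ w, (E.adjMatrix v w : ℝ) * y w
    rw [← Finset.sum_fiberwise (Finset.univ.filter fun e => E.r e = v) E.s]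
    refine Finset.sum_congr rfl fun w _ => ?_
    rw [Finset.filter_filter, Finset.sum_congr rfl (g := fun _ => y w)]
    · rw [Finset.sum_const, nsmul_eq_mul, DirectedGraph.adjMatrix, Matrix.of_apply,
        Fintype.card_subtype]
      norm_cast
    · intro e he
      rw [(Finset.mem_filter.1 he).2.2]

end PathSums

/-! ### The partition function -/

section Partition

variable {V E₁ : Type u} [Fintype V] [Fintype E₁] {E : DirectedGraph V E₁}

theorem exp_mul_sum_pathN_source [DecidableEq V] (β : ℝ) (x : V → ℝ) (k : ℕ) (v : V) :
    Real.exp (-(β * k)) * ∑ μ : E.PathN v k, x μ.1.source = (expAdj E β ^ k).mulVec x v := by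
  rw [sum_pathN_source, expAdj, smul_pow, Matrix.smul_mulVec, Pi.smul_apply, smul_eq_mul,
    ← Real.exp_nat_mul]
  congr 2
  ring

variable [Groupoid.{u} V]

theorem vertexVector_nonneg (τ : TracialState (GroupoidCStar V)) (v : V) :
    0 ≤ vertexVector τ v := by
  have h : star (GroupoidCStar.u (𝟙 v)) * GroupoidCStar.u (𝟙 v) = GroupoidCStar.u (𝟙 v) :=
    Subtype.ext (BoundedProd.ext fun π => π.star_v_mul_v (𝟙 v))
  have h' := τ.nonneg (GroupoidCStar.u (𝟙 v))
  rw [h] at h'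
  exact (Complex.le_def.1 h').1

theorem sum_vertexVector (τ : TracialState (GroupoidCStar V)) : ∑ v, vertexVector τ v = 1 := by
  have h := congrArg τ.toLinearMap (GroupoidCStar.sum_u (V := V))
  rw [map_sum, τ.map_one] at h
  have := congrArg Complex.re h
  rwa [Complex.re_sum] at this

theorem partitionTerm_nonneg (β : ℝ) (τ : TracialState (GroupoidCStar V)) (k : ℕ) :
    0 ≤ partitionTerm E β τ k :=
  mul_nonneg (Real.exp_pos _).le
    (Finset.sum_nonneg fun _ _ => Finset.sum_nonneg fun _ _ => vertexVector_nonneg τ _)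

variable [DecidableEq V]

theorem hasSum_partitionTerm {β : ℝ}
    (hβ : ENNReal.log (spectralRadius ℂ (E.adjMatrix.map (Int.cast : ℤ → ℂ))) < (β : EReal))
    (τ : TracialState (GroupoidCStar V)) :
    HasSum (partitionTerm E β τ) (∑ v, (vonNeumannMatrix E β).mulVec (vertexVector τ) v) := by
  have h := hasSum_sum fun v (_ : v ∈ Finset.univ) =>
    hasSum_expAdj_pow_mulVec hβ (vertexVector τ) v
  refine h.congr_fun fun k => ?_
  rw [partitionTerm, Finset.mul_sum]
  exact Finset.sum_congr rfl fun v _ => exp_mul_sum_pathN_source β _ k v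

theorem partitionFunction_pos {β : ℝ}
    (hβ : ENNReal.log (spectralRadius ℂ (E.adjMatrix.map (Int.cast : ℤ → ℂ))) < (β : EReal))
    (τ : TracialState (GroupoidCStar V)) : 0 < partitionFunction E β τ := by
  refine (hasSum_partitionTerm hβ τ).summable.tsum_pos (partitionTerm_nonneg β τ) 0 ?_
  -- The term of length zero is Σ_v τ(u_v) = τ(1), which makes the sum strictly positive.
  have : partitionTerm E β τ 0 = 1 := by
    have h0 : ∀ v : V, ∑ μ : E.PathN v 0, vertexVector τ μ.1.source = vertexVector τ v := fun v =>
      sum_pathN_zero E v fun l => vertexVector τ (E.listSource v l)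
    simp [partitionTerm, h0, sum_vertexVector]
  rw [this]
  exact one_pos

end Partition

/-! ### Calculus of paths and restrictions -/

namespace DirectedGraph

variable {V E₁ : Type u} {E : DirectedGraph V E₁}

theorem PIso.ext {v w : V} {p q : E.PIso v w} (h : ∀ μ, p.toEquiv μ = q.toEquiv μ) : p = q := by
  cases p; cases q
  congr
  exact Equiv.ext h

theorem listSource_append (v : V) (l m : List E₁) :
    E.listSource v (l ++ m) = E.listSource (E.listSource v l) m := by
  induction l generalizing v with
  | nil => rfl
  | cons e l ih => exact ih (E.s e)

theorem Path.source_append {v : V} (μ : E.Path v) (ν : E.Path μ.source) :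
    (μ.append ν).source = ν.source :=
  listSource_append v μ.1 ν.1

variable (E) in
/-- The path of length zero. -/
def vertexPath (v : V) : E.Path v := ⟨[], trivial⟩

/-- The path `eμ`. -/
def consPath (e : E₁) (μ : E.Path (E.s e)) : E.Path (E.r e) := ⟨e :: μ.1, rfl, μ.2⟩

end DirectedGraph

open DirectedGraph

namespace SelfSimilarAction

variable {V E₁ : Type u} [Groupoid.{u} V] {E : DirectedGraph V E₁} (S : SelfSimilarAction E)

theorem act_id (v : V) (μ : E.Path v) : S.act (𝟙 v) μ = μ := S.map_id v μ

theorem act_comp {v w x : V} (g : v ⟶ w) (h : w ⟶ x) (μ : E.Path v) :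
    S.act (g ≫ h) μ = S.act h (S.act g μ) := S.map_comp g h μ

theorem act_injective {v w : V} (g : v ⟶ w) : Function.Injective (S.act g) :=
  (S.θ g).toEquiv.injective

theorem length_act {v w : V} (g : v ⟶ w) (μ : E.Path v) : (S.act g μ).1.length = μ.1.length :=
  (S.θ g).length_eq μ

theorem hom_ext {v w : V} {g h : v ⟶ w} (H : ∀ μ, S.act g μ = S.act h μ) : g = h :=
  S.faithful (PIso.ext H)

/-- Restrictions are unique, by faithfulness. -/
theorem restr_heq {v w x : V} (g : v ⟶ w) (μ : E.Path v) (h : μ.source ⟶ x)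
    (hx : x = (S.act g μ).source)
    (H : ∀ ν, (S.act g (μ.append ν)).1 = (S.act g μ).1 ++ (S.act h ν).1) :
    HEq (S.restr g μ) h := by
  subst hx
  refine heq_of_eq (S.hom_ext fun ν => Subtype.ext ?_)
  have h1 := congrArg Subtype.val (S.act_append g μ ν)
  rw [H ν] at h1
  exact (List.append_cancel_left h1).symm

/-- This and the next two identities are heterogeneous because the terminus of a restriction is the
source of a translated path, which agrees with the expected vertex only after rewriting that path.
-/
theorem restr_id_heq (v : V) (μ : E.Path v) : HEq (S.restr (𝟙 v) μ) (𝟙 μ.source) :=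
  S.restr_heq _ _ _ (by rw [act_id]) fun ν => by rw [act_id, act_id, act_id]; rfl

theorem restr_comp_heq {v w x : V} (g : v ⟶ w) (h : w ⟶ x) (μ : E.Path v) :
    HEq (S.restr (g ≫ h) μ) (S.restr g μ ≫ S.restr h (S.act g μ)) :=
  S.restr_heq _ _ _ (by rw [act_comp]) fun ν => by
    rw [act_comp, act_append, act_append, act_comp, act_comp]; rfl

/-- The rule g|_{eμ} = (g|_e)|_μ: both elements describe how g acts on extensions of eμ, so
uniqueness of restrictions applies. -/
theorem restr_consPath_heq {w : V} (e : E₁) (g : E.r e ⟶ w) (μ : E.Path (E.s e)) :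
    HEq (S.restr g (consPath e μ))
      (S.restr (v := E.s e) (S.restr g (E.edgePath e)) μ) := by
  have h0 : ∀ ν : E.Path (E.s e), S.act g (consPath e ν) =
      (S.act g (E.edgePath e)).append (S.act (v := E.s e) (S.restr g (E.edgePath e)) ν) :=
    fun ν => S.act_append g (E.edgePath e) ν
  refine S.restr_heq g (consPath e μ)
    (S.restr (v := E.s e) (S.restr g (E.edgePath e)) μ) ?_ fun ν => ?_
  · rw [h0 μ, Path.source_append]
  · have h1 : (consPath e μ).append ν = consPath e (μ.append ν) := rfl
    rw [h1, h0, h0]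
    have h2 := congrArg Subtype.val
      (S.act_append (v := E.s e) (S.restr g (E.edgePath e)) μ ν)
    change _ ++ (S.act (v := E.s e) _ (μ.append ν)).1 = (_ ++ _) ++ _
    rw [h2, List.append_assoc]
    rfl

/-! ## The index set of the Fock representation -/

variable (E) in
/-- The pairs of a path `μ` and a groupoid element with terminus `s(μ)`. -/
structure _root_.SelfSim.FockIndex : Type u where
  range : V
  path : E.Path range
  dom : V
  hom : dom ⟶ path.source

variable (E) in
/-- The pair of a path and the unit at its source. -/
def unitIndex (w : V) (μ : E.Path w) : FockIndex E := ⟨w, μ, μ.source, 𝟙 _⟩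

theorem fockIndex_ext {w : V} {μ μ' : E.Path w} {x : V} {h : x ⟶ μ.source} {h' : x ⟶ μ'.source}
    (hμ : μ = μ') (hh : HEq h h') :
    (⟨w, μ, x, h⟩ : FockIndex E) = ⟨w, μ', x, h'⟩ := by
  subst hμ
  rw [eq_of_heq hh]

theorem _root_.SelfSim.FockIndex.rec_path {motive : FockIndex E → Prop}
    (nil : ∀ (w z : V) (h : z ⟶ w), motive ⟨w, E.vertexPath w, z, h⟩)
    (cons : ∀ (e : E₁) (μ : E.Path (E.s e)) (z : V) (h : z ⟶ μ.source),
      motive ⟨E.r e, consPath e μ, z, h⟩) (i : FockIndex E) : motive i :=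
  match i with
  | ⟨_, ⟨[], _⟩, _, h⟩ => nil _ _ h
  | ⟨_, ⟨e :: l, ⟨rfl, hl⟩⟩, _, h⟩ => cons e ⟨l, hl⟩ _ h

theorem comp_heq {x y z z' : V} (h : x ⟶ y) {a : y ⟶ z} {a' : y ⟶ z'} (hz : z = z')
    (ha : HEq a a') : HEq (h ≫ a) (h ≫ a') := by
  subst hz
  rw [eq_of_heq ha]

open Classical in
/-- The action of a groupoid element on the index set. -/
def actFun {x y : V} (g : x ⟶ y) (i : FockIndex E) : Option (FockIndex E) :=
  if hw : i.range = x then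
    some ⟨y, S.act g (hw ▸ i.path), i.dom,
      i.hom ≫ eqToHom (by cases hw; rfl) ≫ S.restr g (hw ▸ i.path)⟩
  else none

theorem actFun_self {x y : V} (g : x ⟶ y) (μ : E.Path x) (z : V) (h : z ⟶ μ.source) :
    S.actFun g ⟨x, μ, z, h⟩ = some ⟨y, S.act g μ, z, h ≫ S.restr g μ⟩ := by
  unfold actFun
  rw [dif_pos rfl]
  congr 3
  exact Category.id_comp _

theorem actFun_ne {x y : V} (g : x ⟶ y) {i : FockIndex E} (hi : i.range ≠ x) :
    S.actFun g i = none :=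
  dif_neg hi

/-- The cocycle identity for restrictions makes (μ,h) ↦ (g·μ, g|_μ h) multiplicative in g. -/
theorem actFun_bind {x y z : V} (g : x ⟶ y) (h : y ⟶ z) (i : FockIndex E) :
    (S.actFun g i).bind (S.actFun h) = S.actFun (g ≫ h) i := by
  obtain ⟨w, μ, a, k⟩ := i
  by_cases hw : w = x
  · subst hw
    rw [actFun_self, Option.bind_some, actFun_self, actFun_self]
    refine congrArg some (fockIndex_ext (S.act_comp g h μ).symm ?_)
    rw [Category.assoc]
    exact comp_heq _ (by rw [act_comp]) (S.restr_comp_heq g h μ).symm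
  · rw [S.actFun_ne g hw, S.actFun_ne _ hw, Option.bind_none]

theorem actFun_bind_ne {x y x' z : V} (g : x ⟶ y) (h : x' ⟶ z) (hne : x' ≠ y) (i : FockIndex E) :
    (S.actFun g i).bind (S.actFun h) = none := by
  obtain ⟨w, μ, a, k⟩ := i
  by_cases hw : w = x
  · subst hw
    rw [actFun_self, Option.bind_some, S.actFun_ne _ (Ne.symm hne)]
  · rw [S.actFun_ne _ hw, Option.bind_none]

theorem actFun_id_self (w : V) (i : FockIndex E) (hi : i.range = w) :
    S.actFun (𝟙 w) i = some i := by
  obtain ⟨w, μ, a, k⟩ := i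
  cases hi
  rw [actFun_self]
  refine congrArg some (fockIndex_ext (S.act_id w μ) ?_)
  refine (comp_heq k (by rw [act_id]) (S.restr_id_heq w μ)).trans (heq_of_eq ?_)
  exact Category.comp_id k

theorem range_of_actFun_eq_some {x y : V} {g : x ⟶ y} {i j : FockIndex E}
    (h : S.actFun g i = some j) : i.range = x := by
  by_contra hne
  rw [S.actFun_ne _ hne] at h
  cases h

theorem actFun_inv {x y : V} (g : x ⟶ y) {i j : FockIndex E} (h : S.actFun g i = some j) :
    S.actFun (Groupoid.inv g) j = some i := by
  have := S.actFun_bind g (Groupoid.inv g) i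
  rwa [h, Groupoid.comp_inv, actFun_id_self _ _ _ (S.range_of_actFun_eq_some h),
    Option.bind_some] at this

/-- The action of a groupoid element as a partial bijection of the index set. -/
def actPEquiv {x y : V} (g : x ⟶ y) : FockIndex E ≃. FockIndex E where
  toFun := S.actFun g
  invFun := S.actFun (Groupoid.inv g)
  inv i j := by
    refine ⟨fun h => ?_, fun h => S.actFun_inv g h⟩
    have := S.actFun_inv (Groupoid.inv g) h
    rwa [Groupoid.inv_eq_inv, Groupoid.inv_eq_inv, IsIso.inv_inv] at this

theorem actPEquiv_apply {x y : V} (g : x ⟶ y) (i : FockIndex E) :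
    S.actPEquiv g i = S.actFun g i := rfl

theorem actPEquiv_symm {x y : V} (g : x ⟶ y) :
    (S.actPEquiv g).symm = S.actPEquiv (Groupoid.inv g) :=
  PEquiv.ext fun _ => rfl

theorem actPEquiv_trans {x y z : V} (g : x ⟶ y) (h : y ⟶ z) :
    (S.actPEquiv g).trans (S.actPEquiv h) = S.actPEquiv (g ≫ h) :=
  PEquiv.ext fun i => S.actFun_bind g h i

theorem actPEquiv_trans_ne {x y x' z : V} (g : x ⟶ y) (h : x' ⟶ z) (hne : x' ≠ y) :
    (S.actPEquiv g).trans (S.actPEquiv h) = ⊥ :=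
  PEquiv.ext fun i => S.actFun_bind_ne g h hne i

open Classical in
/-- Adding the edge `e` to a path. -/
def createFun (e : E₁) (i : FockIndex E) : Option (FockIndex E) :=
  if hw : i.range = E.s e then
    some ⟨E.r e, consPath e (hw ▸ i.path), i.dom, i.hom ≫ eqToHom (by cases i; cases hw; rfl)⟩
  else none

open Classical in
/-- Removing the edge `e` from a path. -/
def removeFun (e : E₁) : FockIndex E → Option (FockIndex E)
  | ⟨_, ⟨[], _⟩, _, _⟩ => none
  | ⟨_, ⟨f :: l, hl⟩, z, k⟩ => if f = e then some ⟨E.s f, ⟨l, hl.2⟩, z, k⟩ else none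

theorem createFun_self (e : E₁) (μ : E.Path (E.s e)) (z : V) (h : z ⟶ μ.source) :
    createFun e ⟨E.s e, μ, z, h⟩ = some ⟨E.r e, consPath e μ, z, h⟩ := by
  unfold createFun
  rw [dif_pos rfl]
  congr 3
  exact Category.comp_id h

theorem createFun_ne (e : E₁) {i : FockIndex E} (hi : i.range ≠ E.s e) : createFun e i = none :=
  dif_neg hi

theorem removeFun_vertexPath (e : E₁) (w z : V) (h : z ⟶ w) :
    removeFun e (⟨w, E.vertexPath w, z, h⟩ : FockIndex E) = none := rfl

theorem removeFun_consPath_self (e : E₁) (μ : E.Path (E.s e)) (z : V) (h : z ⟶ μ.source) :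
    removeFun e (⟨E.r e, consPath e μ, z, h⟩ : FockIndex E) = some ⟨E.s e, μ, z, h⟩ :=
  if_pos rfl

theorem removeFun_consPath_ne {e f : E₁} (hf : f ≠ e) (μ : E.Path (E.s f)) (z : V)
    (h : z ⟶ μ.source) : removeFun e (⟨E.r f, consPath f μ, z, h⟩ : FockIndex E) = none :=
  if_neg hf

/-- Adding an edge, as a partial bijection of the index set. -/
def createPEquiv (e : E₁) : FockIndex E ≃. FockIndex E where
  toFun := createFun e
  invFun := removeFun e
  inv i j := by
    constructor
    · intro h
      induction j using FockIndex.rec_path with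
      | nil => cases h
      | cons f μ z k =>
        by_cases hf : f = e
        · subst hf
          rw [removeFun_consPath_self] at h
          obtain rfl := Option.some.inj h
          exact createFun_self f μ z k
        · rw [removeFun_consPath_ne hf] at h
          cases h
    · intro h
      obtain ⟨w, μ, z, k⟩ := i
      by_cases hw : w = E.s e
      · subst hw
        rw [createFun_self] at h
        obtain rfl := Option.some.inj h
        exact removeFun_consPath_self e μ z k
      · rw [createFun_ne e hw] at h
        cases h

end SelfSimilarAction

open DirectedGraph SelfSimilarAction

open scoped ComplexOrder in
theorem CState.apply_star {A : Type*} [CStarAlgebra A] (φ : CState A) (a : A) :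
    φ (star a) = (starRingEnd ℂ) (φ a) := by
  let _ : PartialOrder A := CStarAlgebra.spectralOrder A
  have : StarOrderedRing A := CStarAlgebra.spectralOrderedRing A
  have h : ∀ a : A, 0 ≤ a → 0 ≤ φ.toLinearMap a := by
    intro a ha
    obtain ⟨b, rfl⟩ := CStarAlgebra.nonneg_iff_eq_star_mul_self.1 ha
    exact φ.nonneg b
  exact map_star (PositiveLinearMap.mk₀ φ.toLinearMap h) a

/-- A form that couples only indices with equal label is block diagonal; used with paths as labels
to show that the Fock kernel is positive. -/
theorem sum_sum_ite_eq_sum_fiberwise {I P M : Type*} [AddCommMonoid M] [DecidableEq P]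
    (s : Finset I) (p : I → P) (F : I → I → M) :
    ∑ i ∈ s, ∑ j ∈ s, (if p i = p j then F i j else 0) =
      ∑ q ∈ s.image p, ∑ i ∈ s with p i = q, ∑ j ∈ s with p j = q, F i j := by
  rw [← Finset.sum_fiberwise_of_maps_to (g := p) fun i hi => Finset.mem_image_of_mem p hi]
  refine Finset.sum_congr rfl fun q _ => Finset.sum_congr rfl fun i hi => ?_
  rw [Finset.sum_filter, (Finset.mem_filter.1 hi).2]
  exact Finset.sum_congr rfl fun j _ => by simp only [eq_comm]

section Index

variable {V E₁ : Type u} [Groupoid.{u} V] {E : DirectedGraph V E₁} (S : SelfSimilarAction E)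

/-- The path of an element of the index set, with its range. -/
def FockIndex.key (i : FockIndex E) : Σ w : V, E.Path w := ⟨i.range, i.path⟩

theorem FockIndex.range_eq_of_key {i j : FockIndex E} (h : i.key = j.key) : i.range = j.range :=
  congrArg Sigma.fst h

theorem actFun_eq_none_iff {x y : V} (g : x ⟶ y) (i : FockIndex E) :
    S.actFun g i = none ↔ i.range ≠ x := by
  refine ⟨fun h hi => ?_, S.actFun_ne g⟩
  obtain ⟨w, μ, z, k⟩ := i
  cases hi
  rw [actFun_self] at h
  cases h

theorem createFun_eq_none_iff (e : E₁) (i : FockIndex E) :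
    createFun e i = none ↔ i.range ≠ E.s e := by
  refine ⟨fun h hi => ?_, createFun_ne e⟩
  obtain ⟨w, μ, z, k⟩ := i
  cases hi
  rw [createFun_self] at h
  cases h

theorem removeFun_eq_none_iff (e : E₁) (i : FockIndex E) :
    removeFun e i = none ↔ i.path.1.head? ≠ some e := by
  induction i using FockIndex.rec_path with
  | nil w z h =>
    refine ⟨fun _ h => ?_, fun _ => rfl⟩
    cases h
  | cons f μ z k =>
    by_cases hf : f = e
    · subst hf
      rw [removeFun_consPath_self]
      refine ⟨fun h => ?_, fun h => absurd rfl h⟩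
      cases h
    · rw [removeFun_consPath_ne hf]
      exact ⟨fun _ h => hf (Option.some.inj h), fun _ => rfl⟩

/-- The relation u_g s_e = s_{g·e} u_{g|_e} already holds for partial bijections of the index set,
because g·(eμ) = f(g|_e·μ) and g|_{eμ} = (g|_e)|_μ. -/
theorem actFun_createFun {w : V} (e f : E₁) (g : E.r e ⟶ w)
    (hf : (S.act g (E.edgePath e)).1 = [f]) (i : FockIndex E) :
    (createFun e i).bind (S.actFun g) =
      (S.actFun (x := E.s e) (S.restr g (E.edgePath e)) i).bind (createFun f) := by
  obtain ⟨v, μ, z, h⟩ := i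
  by_cases hv : v = E.s e
  · subst hv
    -- The restriction g|_e and its terminus are generalised to k and y, so that the equations with
    -- s(f) and r(f) can be substituted.
    have key : ∀ (y : V) (k : E.s e ⟶ y), y = E.s f → w = E.r f →
        (S.act g (consPath e μ)).1 = f :: (S.act k μ).1 →
        HEq (S.restr g (consPath e μ)) (S.restr k μ) →
        (createFun e ⟨E.s e, μ, z, h⟩).bind (S.actFun g) =
          (S.actFun k ⟨E.s e, μ, z, h⟩).bind (createFun f) := by
      rintro _ k rfl rfl h1 h2
      have h4 : (createFun e ⟨E.s e, μ, z, h⟩).bind (S.actFun g) =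
          some ⟨E.r f, S.act g (consPath e μ), z, h ≫ S.restr g (consPath e μ)⟩ := by
        refine (congrArg (fun o => o.bind (S.actFun g)) (createFun_self e μ z h)).trans ?_
        exact S.actFun_self g (consPath e μ) z h
      have h5 : (S.actFun k ⟨E.s e, μ, z, h⟩).bind (createFun f) =
          some ⟨E.r f, consPath f (S.act k μ), z, h ≫ S.restr k μ⟩ := by
        rw [actFun_self, Option.bind_some, createFun_self]
        rfl
      refine h4.trans (Eq.trans ?_ h5.symm)
      have h3 : S.act g (consPath e μ) = consPath f (S.act k μ) := Subtype.ext h1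
      refine congrArg some (fockIndex_ext h3 ?_)
      exact comp_heq h (congrArg (fun p : E.Path _ => p.source) h3) h2
    have h4 := (S.act g (E.edgePath e)).2
    rw [hf] at h4
    refine key _ _ ?_ h4.1.symm ?_ (S.restr_consPath_heq e g μ)
    · change E.listSource w _ = _
      rw [hf]
      rfl
    · have := congrArg Subtype.val (S.act_append g (E.edgePath e) μ)
      change _ = (S.act g (E.edgePath e)).1 ++ _ at this
      rw [hf] at this
      exact this
  · have h1 : createFun e ⟨v, μ, z, h⟩ = none := createFun_ne e hv
    have h2 : S.actFun (x := E.s e) (S.restr g (E.edgePath e)) ⟨v, μ, z, h⟩ = none :=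
      S.actFun_ne _ hv
    exact (congrArg (fun o => o.bind (S.actFun g)) h1).trans
      (congrArg (fun o => o.bind (createFun f)) h2).symm

end Index

/-! ### The Fock representation induced from a state -/

section Fock

variable {V E₁ : Type u} [Fintype V] [Groupoid.{u} V] {E : DirectedGraph V E₁}

open Classical in
variable (E) in
/-- The kernel of the Fock representation induced from a state of the groupoid algebra. -/
def fockKernel (φ : CState (GroupoidCStar V)) : PosKernel (FockIndex E) where
  K i j := if i.key = j.key then φ (star (GroupoidCStar.u i.hom) * GroupoidCStar.u j.hom) else 0
  conj_symm i j := by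
    by_cases h : i.key = j.key
    · rw [if_pos h, if_pos h.symm, ← φ.apply_star, star_mul, star_star]
    · rw [if_neg h, if_neg (Ne.symm h), map_zero]
  nonneg x := by
    -- The block of a path q contributes φ(b^* b), where b is the combination of the u_h with
    -- coefficients x over the indices with path q.
    have h1 : (x.sum fun i a => x.sum fun j b => (starRingEnd ℂ) a * b *
        (if i.key = j.key then φ (star (GroupoidCStar.u i.hom) * GroupoidCStar.u j.hom) else 0)) =
        ∑ q ∈ x.support.image FockIndex.key,
          φ (star (∑ i ∈ x.support with i.key = q, x i • GroupoidCStar.u i.hom) *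
            ∑ i ∈ x.support with i.key = q, x i • GroupoidCStar.u i.hom) := by
      unfold Finsupp.sum
      simp only [mul_ite, mul_zero]
      rw [sum_sum_ite_eq_sum_fiberwise]
      refine Finset.sum_congr rfl fun q _ => ?_
      rw [star_sum, Finset.sum_mul_sum, map_sum]
      refine Finset.sum_congr rfl fun i _ => ?_
      rw [map_sum]
      refine Finset.sum_congr rfl fun j _ => ?_
      rw [star_smul, smul_mul_smul_comm, map_smul, smul_eq_mul]
      rfl
    rw [h1, Complex.re_sum]
    exact Finset.sum_nonneg fun q _ => (Complex.le_def.1 (φ.nonneg _)).1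

variable (φ : CState (GroupoidCStar V))

theorem fockKernel_mk {w x y : V} {μ : E.Path w} (h : x ⟶ μ.source) (k : y ⟶ μ.source) :
    (fockKernel E φ).K ⟨w, μ, x, h⟩ ⟨w, μ, y, k⟩ =
      φ (star (GroupoidCStar.u h) * GroupoidCStar.u k) :=
  if_pos rfl

theorem fockKernel_of_key_ne {i j : FockIndex E} (h : i.key ≠ j.key) :
    (fockKernel E φ).K i j = 0 :=
  if_neg h

/-- If the domain and the range of f are unions of key classes, then whenever only one side of the
adjointness identity is defined, its two indices have different keys and the kernel vanishes there.
Where both sides are defined, invariance of the kernel is what is needed. -/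
theorem admissible_of_key {f : FockIndex E ≃. FockIndex E}
    (h1 : ∀ i i' j j', f i = some i' → f j = some j' →
      (fockKernel E φ).K i' j' = (fockKernel E φ).K i j)
    (h2 : ∀ i j : FockIndex E, i.key = j.key → f i = none → f j = none)
    (h3 : ∀ i j : FockIndex E, i.key = j.key → f.symm i = none → f.symm j = none) :
    (fockKernel E φ).Admissible f := by
  intro i j
  cases hi : f i with
  | none =>
    cases hj : f.symm j with
    | none => rw [Option.elim_none, Option.elim_none]
    | some j' =>
      rw [Option.elim_none, Option.elim_some, fockKernel_of_key_ne]
      intro hk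
      have := h2 _ _ hk hi
      rw [(PEquiv.eq_some_iff f).1 hj] at this
      cases this
  | some i' =>
    cases hj : f.symm j with
    | none =>
      rw [Option.elim_none, Option.elim_some, fockKernel_of_key_ne]
      intro hk
      have := h3 _ _ hk.symm hj
      rw [(PEquiv.eq_some_iff f).2 hi] at this
      cases this
    | some j' =>
      rw [Option.elim_some, Option.elim_some]
      exact h1 _ _ _ _ hi ((PEquiv.eq_some_iff f).1 hj)

variable (S : SelfSimilarAction E)

/-- On the block of μ, g multiplies by u_{g|_μ} from the left, and u_{g|_μ}^* u_{g|_μ} is the unit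
at s(μ), so Gram entries are preserved. Different paths stay different because g acts injectively.
-/
theorem admissible_act {x y : V} (g : x ⟶ y) :
    (fockKernel E φ).Admissible (S.actPEquiv g) := by
  refine admissible_of_key φ ?_ ?_ ?_
  · rintro i i' j j' hi hj
    rw [actPEquiv_apply] at hi hj
    have hi' := S.range_of_actFun_eq_some hi
    have hj' := S.range_of_actFun_eq_some hj
    obtain ⟨w, μ, a, h⟩ := i
    obtain ⟨w', ν, b, k⟩ := j
    cases hi'
    cases hj'
    rw [actFun_self] at hi hj
    obtain rfl := Option.some.inj hi
    obtain rfl := Option.some.inj hj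
    by_cases hμ : μ = ν
    · subst hμ
      refine (fockKernel_mk φ _ _).trans (Eq.trans ?_ (fockKernel_mk φ _ _).symm)
      change φ (star (GroupoidCStar.u (h ≫ S.restr g μ)) * GroupoidCStar.u (k ≫ S.restr g μ)) =
        φ (star (GroupoidCStar.u h) * GroupoidCStar.u k)
      rw [← GroupoidCStar.u_mul, ← GroupoidCStar.u_mul, star_mul, mul_assoc,
        ← mul_assoc (star (GroupoidCStar.u (S.restr g μ))), GroupoidCStar.star_u (S.restr g μ),
        GroupoidCStar.u_mul, Groupoid.comp_inv, GroupoidCStar.u_mul, Category.comp_id]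
    · rw [fockKernel_of_key_ne, fockKernel_of_key_ne]
      · intro he
        exact hμ (eq_of_heq (Sigma.mk.inj he).2)
      · intro he
        exact hμ (S.act_injective g (eq_of_heq (Sigma.mk.inj he).2))
  · intro i j hk hi
    rw [actPEquiv_apply, actFun_eq_none_iff] at *
    rwa [← FockIndex.range_eq_of_key hk]
  · intro i j hk hi
    rw [actPEquiv_symm, actPEquiv_apply, actFun_eq_none_iff] at *
    rwa [← FockIndex.range_eq_of_key hk]

theorem admissible_create (e : E₁) : (fockKernel E φ).Admissible (createPEquiv e) := by
  refine admissible_of_key φ ?_ ?_ ?_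
  · rintro i i' j j' hi hj
    change createFun e i = _ at hi
    change createFun e j = _ at hj
    have hi' : i.range = E.s e := by
      by_contra hne; rw [createFun_ne e hne] at hi; cases hi
    have hj' : j.range = E.s e := by
      by_contra hne; rw [createFun_ne e hne] at hj; cases hj
    obtain ⟨w, μ, a, h⟩ := i
    obtain ⟨w', ν, b, k⟩ := j
    cases hi'
    cases hj'
    rw [createFun_self] at hi hj
    obtain rfl := Option.some.inj hi
    obtain rfl := Option.some.inj hj
    by_cases hμ : μ = ν
    · subst hμ
      exact (fockKernel_mk φ (μ := consPath e μ) h k).trans (fockKernel_mk φ h k).symm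
    · rw [fockKernel_of_key_ne, fockKernel_of_key_ne]
      · intro he
        exact hμ (eq_of_heq (Sigma.mk.inj he).2)
      · intro he
        have h2 := congrArg Subtype.val (eq_of_heq (Sigma.mk.inj he).2)
        exact hμ (Subtype.ext (List.cons.inj h2).2)
  · intro i j hk hi
    change createFun e j = none
    change createFun e i = none at hi
    rw [createFun_eq_none_iff] at *
    rwa [← FockIndex.range_eq_of_key hk]
  · intro i j hk hi
    change removeFun e j = none
    change removeFun e i = none at hi
    rw [removeFun_eq_none_iff] at *
    have : i.path.1 = j.path.1 := congrArg (fun k : Σ w : V, E.Path w => k.2.1) hk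
    rwa [← this]

theorem op_act_vec_self {x y : V} (g : x ⟶ y) (μ : E.Path x) (z : V) (h : z ⟶ μ.source) :
    (fockKernel E φ).op (S.actPEquiv g) ((fockKernel E φ).vec ⟨x, μ, z, h⟩) =
      (fockKernel E φ).vec ⟨y, S.act g μ, z, h ≫ S.restr g μ⟩ := by
  rw [PosKernel.op_vec (admissible_act φ S g), actPEquiv_apply, actFun_self]
  rfl

theorem op_act_vec_ne {x y : V} (g : x ⟶ y) {i : FockIndex E} (hi : i.range ≠ x) :
    (fockKernel E φ).op (S.actPEquiv g) ((fockKernel E φ).vec i) = 0 := by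
  rw [PosKernel.op_vec (admissible_act φ S g), actPEquiv_apply, S.actFun_ne g hi]
  rfl

theorem op_act_id_vec (i : FockIndex E) :
    (fockKernel E φ).op (S.actPEquiv (𝟙 i.range)) ((fockKernel E φ).vec i) =
      (fockKernel E φ).vec i := by
  rw [PosKernel.op_vec (admissible_act φ S _), actPEquiv_apply, actFun_id_self _ _ _ rfl]
  rfl

theorem op_create_vec_self (e : E₁) (μ : E.Path (E.s e)) (z : V) (h : z ⟶ μ.source) :
    (fockKernel E φ).op (createPEquiv e) ((fockKernel E φ).vec ⟨E.s e, μ, z, h⟩) =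
      (fockKernel E φ).vec ⟨E.r e, consPath e μ, z, h⟩ := by
  rw [PosKernel.op_vec (admissible_create φ e)]
  change Option.elim (createFun e _) _ _ = _
  rw [createFun_self]
  rfl

theorem op_create_vec_ne (e : E₁) {i : FockIndex E} (hi : i.range ≠ E.s e) :
    (fockKernel E φ).op (createPEquiv e) ((fockKernel E φ).vec i) = 0 := by
  rw [PosKernel.op_vec (admissible_create φ e)]
  change Option.elim (createFun e _) _ _ = _
  rw [createFun_ne e hi]
  rfl

theorem star_op_create_vec (e : E₁) (i : FockIndex E) :
    star ((fockKernel E φ).op (createPEquiv e)) ((fockKernel E φ).vec i) =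
      (removeFun e i).elim 0 (fockKernel E φ).vec := by
  rw [PosKernel.star_op (admissible_create φ e), PosKernel.op_vec (admissible_create φ e).symm]
  rfl

theorem inner_unitIndex (w : V) (μ : E.Path w) :
    inner ℂ ((fockKernel E φ).vec (unitIndex E w μ)) ((fockKernel E φ).vec (unitIndex E w μ)) =
      φ (GroupoidCStar.u (𝟙 μ.source)) := by
  rw [PosKernel.inner_vec, unitIndex, fockKernel_mk, GroupoidCStar.star_u, GroupoidCStar.u_mul, Groupoid.comp_inv]

variable (E) in
-- Since Σ_v φ(u_v) = 1, some φ(u_v) is nonzero, and it is the squared norm of the vector (v,1).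
theorem nontrivial_fock : Nontrivial (fockKernel E φ).Hilb := by
  have h : ∃ v : V, φ (GroupoidCStar.u (𝟙 v)) ≠ 0 := by
    by_contra! h
    have h1 := congrArg φ.toLinearMap (GroupoidCStar.sum_u (V := V))
    rw [map_sum, φ.map_one, Finset.sum_eq_zero fun v _ => h v] at h1
    exact zero_ne_one h1
  obtain ⟨v, hv⟩ := h
  refine ⟨(fockKernel E φ).vec (unitIndex E v (E.vertexPath v)), 0, fun h0 => hv ?_⟩
  have := inner_unitIndex φ v (E.vertexPath v)
  rw [h0, inner_zero_left] at this
  exact this.symm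

/-- The defect of the Toeplitz relation: the part of the index set over the vertices. -/
def vertexPEquiv (w : V) : FockIndex E ≃. FockIndex E :=
  open Classical in PEquiv.ofSet {i | i.key = ⟨w, E.vertexPath w⟩}

theorem admissible_vertex (w : V) : (fockKernel E φ).Admissible (vertexPEquiv w) := by
  classical
  have h2 : ∀ i j : FockIndex E, i.key = j.key → vertexPEquiv w i = none →
      vertexPEquiv w j = none := by
    intro i j hk hi
    by_contra hne
    obtain ⟨j', hj'⟩ := Option.ne_none_iff_exists'.1 hne
    have h1 := (PEquiv.ofSet_eq_some_iff.1 hj').2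
    rw [(PEquiv.ofSet_eq_some_iff.1 hj').1] at h1
    have h2 : vertexPEquiv w i = some i := PEquiv.ofSet_eq_some_self_iff.2 (hk.trans h1)
    rw [h2] at hi
    cases hi
  -- A partial identity is its own inverse, so one statement covers domain and range.
  refine admissible_of_key φ ?_ h2 h2
  intro i i' j j' hi hj
  rw [(PEquiv.ofSet_eq_some_iff.1 hi).1, (PEquiv.ofSet_eq_some_iff.1 hj).1]

theorem op_vertex_nonneg (w : V) : 0 ≤ (fockKernel E φ).op (vertexPEquiv w) := by
  have h : IsStarProjection ((fockKernel E φ).op (vertexPEquiv w)) := by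
    constructor
    · change _ * _ = _
      rw [PosKernel.op_mul_op (admissible_vertex φ w) (admissible_vertex φ w)]
      congr 1
      refine PEquiv.ext fun i => ?_
      change (vertexPEquiv w i).bind (vertexPEquiv w) = vertexPEquiv w i
      cases hi : vertexPEquiv w i with
      | none => rfl
      | some j =>
        have : i = j := (PEquiv.ofSet_eq_some_iff.1 hi).1.symm
        subst this
        exact hi
    · change star _ = _
      rw [PosKernel.star_op (admissible_vertex φ w)]
      rfl
  exact h.nonneg

theorem op_vertex_vec_self (w z : V) (h : z ⟶ w) :
    (fockKernel E φ).op (vertexPEquiv w) ((fockKernel E φ).vec ⟨w, E.vertexPath w, z, h⟩) =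
      (fockKernel E φ).vec ⟨w, E.vertexPath w, z, h⟩ := by
  rw [PosKernel.op_vec (admissible_vertex φ w)]
  have : vertexPEquiv w (⟨w, E.vertexPath w, z, h⟩ : FockIndex E) =
      some ⟨w, E.vertexPath w, z, h⟩ := PEquiv.ofSet_eq_some_self_iff.2 rfl
  rw [this]
  rfl

theorem op_vertex_vec_ne (w : V) {i : FockIndex E} (hi : i.key ≠ ⟨w, E.vertexPath w⟩) :
    (fockKernel E φ).op (vertexPEquiv w) ((fockKernel E φ).vec i) = 0 := by
  rw [PosKernel.op_vec (admissible_vertex φ w)]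
  have : vertexPEquiv w i = none := if_neg hi
  rw [this]
  rfl

open Classical in
-- The vector (l,1) moves to (g·l, g|_l), which lies in an orthogonal block unless g·l = l. This is
-- the source of the fixed-path sums in the formula for Ψ.
theorem inner_unitIndex_op_act {v : V} (g : v ⟶ v) (l : E.Path v) :
    inner ℂ ((fockKernel E φ).vec (unitIndex E v l))
        ((fockKernel E φ).op (S.actPEquiv g) ((fockKernel E φ).vec (unitIndex E v l))) =
      if S.act g l = l then φ (GroupoidCStar.u (S.restr g l)) else 0 := by
  rw [unitIndex, op_act_vec_self, PosKernel.inner_vec]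
  split_ifs with h
  · have h1 : ∀ (l' : E.Path v) (k : l.source ⟶ l'.source), l' = l →
        (fockKernel E φ).K ⟨v, l, l.source, 𝟙 _⟩ ⟨v, l', l.source, 𝟙 _ ≫ k⟩ =
          φ (GroupoidCStar.u k) := by
      rintro _ k rfl
      rw [fockKernel_mk, GroupoidCStar.star_u, GroupoidCStar.u_mul, Groupoid.inv_eq_inv,
        IsIso.inv_id, Category.comp_id, Category.id_comp]
    exact h1 _ _ h
  · refine fockKernel_of_key_ne φ fun he => h ?_
    exact (eq_of_heq (Sigma.mk.inj he).2).symm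

variable [Fintype E₁]

open Classical in
-- Every path of positive length has a unique first edge, so the ranges of the creation operators
-- miss exactly the paths of length zero. The positive defect gives the Toeplitz inequality.
theorem sum_create_add_vertex (w : V) :
    ∑ e : E₁ with E.r e = w, (fockKernel E φ).op (createPEquiv e) *
      star ((fockKernel E φ).op (createPEquiv e)) + (fockKernel E φ).op (vertexPEquiv w) =
      (fockKernel E φ).op (S.actPEquiv (𝟙 w)) := by
  refine PosKernel.clm_ext _ fun i => ?_
  rw [add_apply, sum_apply]
  simp only [mul_apply_eq_comp, star_op_create_vec]
  induction i using FockIndex.rec_path with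
  | nil w' z h =>
    simp only [removeFun_vertexPath, Option.elim_none, map_zero, Finset.sum_const_zero, zero_add]
    by_cases hw : w' = w
    · subst hw
      rw [op_vertex_vec_self]
      exact (op_act_id_vec φ S ⟨w', E.vertexPath w', z, h⟩).symm
    · rw [op_vertex_vec_ne φ w fun he => hw (Sigma.mk.inj he).1, op_act_vec_ne φ S _ hw]
  | cons f μ z h =>
    have h0 : (FockIndex.key (⟨E.r f, consPath f μ, z, h⟩ : FockIndex E)) ≠
        ⟨w, E.vertexPath w⟩ := by
      intro he
      have := congrArg (fun k : Σ w : V, E.Path w => k.2.1) he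
      cases this
    rw [op_vertex_vec_ne φ w h0, add_zero, Finset.sum_filter, Finset.sum_eq_single f]
    · rw [removeFun_consPath_self, Option.elim_some, op_create_vec_self]
      split_ifs with hw
      · subst hw
        exact (op_act_id_vec φ S ⟨E.r f, consPath f μ, z, h⟩).symm
      · exact (op_act_vec_ne φ S _ hw).symm
    · intro e _ he
      rw [removeFun_consPath_ne (Ne.symm he), Option.elim_none, map_zero, ite_self]
    · intro h
      exact absurd (Finset.mem_univ f) h

open Classical in
/-- The Fock representation induced from a state of the groupoid algebra. -/
def fockRep : ToeplitzRep S where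
  H := (fockKernel E φ).Hilb
  nontrivial := nontrivial_fock E φ
  v g := (fockKernel E φ).op (S.actPEquiv g)
  v_mul h g := by
    rw [PosKernel.op_mul_op (admissible_act φ S h) (admissible_act φ S g), actPEquiv_trans]
  v_mul_eq_zero h g hne := by
    rw [PosKernel.op_mul_op (admissible_act φ S h) (admissible_act φ S g),
      S.actPEquiv_trans_ne h g hne, PosKernel.op_bot]
  v_inv g := by rw [PosKernel.star_op (admissible_act φ S g), actPEquiv_symm]
  sum_v := by
    refine PosKernel.clm_ext _ fun i => ?_
    rw [sum_apply, Finset.sum_eq_single i.range]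
    · exact op_act_id_vec φ S i
    · intro w _ hw
      exact op_act_vec_ne φ S _ (Ne.symm hw)
    · intro h
      exact absurd (Finset.mem_univ _) h
  t e := (fockKernel E φ).op (createPEquiv e)
  star_t_mul_t e := by
    refine PosKernel.clm_ext _ fun i => ?_
    rw [mul_apply_eq_comp]
    obtain ⟨w, μ, z, h⟩ := i
    by_cases hw : w = E.s e
    · subst hw
      rw [op_create_vec_self, star_op_create_vec, removeFun_consPath_self]
      exact (op_act_id_vec φ S ⟨E.s e, μ, z, h⟩).symm
    · rw [op_create_vec_ne φ e hw, map_zero, op_act_vec_ne φ S _ hw]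
  sum_t_mul_star_t_le w := by
    rw [← sum_create_add_vertex φ S w]
    exact le_add_of_nonneg_right (op_vertex_nonneg φ w)
  v_mul_t e f g hf := by
    rw [PosKernel.op_mul_op (admissible_create φ e) (admissible_act φ S g),
      PosKernel.op_mul_op (admissible_act φ S _) (admissible_create φ f)]
    congr 1
    exact PEquiv.ext (actFun_createFun S e f g hf)
  v_mul_t_eq_zero g e hne := by
    refine PosKernel.clm_ext _ fun i => ?_
    rw [mul_apply_eq_comp]
    obtain ⟨w, μ, z, h⟩ := i
    by_cases hw : w = E.s e
    · subst hw
      rw [op_create_vec_self, op_act_vec_ne φ S _ (Ne.symm hne)]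
      rfl
    · rw [op_create_vec_ne φ e hw, map_zero]
      rfl

end Fock

/-! ### Vector functionals of the Fock representation -/

section PsiState

variable {V E₁ : Type u} [Fintype V] [Fintype E₁] [Groupoid.{u} V] {E : DirectedGraph V E₁}

/-- The evaluation of the Toeplitz algebra at a representation. -/
def ToeplitzAlgebra.eval {S : SelfSimilarAction E} (ρ : ToeplitzRep S) :
    ToeplitzAlgebra S →⋆ₐ[ℂ] (ρ.H →L[ℂ] ρ.H) :=
  (BoundedProd.proj ρ).comp (GeneratedCStar.val _)

theorem ToeplitzAlgebra.ext_eval {S : SelfSimilarAction E} {a b : ToeplitzAlgebra S}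
    (h : ∀ ρ, eval ρ a = eval ρ b) : a = b :=
  Subtype.ext (BoundedProd.ext h)

variable (φ : CState (GroupoidCStar V)) (S : SelfSimilarAction E)

/-- The Fock representation as a representation of the Toeplitz algebra. -/
def fockEval : ToeplitzAlgebra S →⋆ₐ[ℂ] ((fockKernel E φ).Hilb →L[ℂ] (fockKernel E φ).Hilb) :=
  ToeplitzAlgebra.eval (fockRep φ S)

theorem fockEval_u {x y : V} (g : x ⟶ y) :
    fockEval φ S (ToeplitzAlgebra.u S g) = (fockKernel E φ).op (S.actPEquiv g) := rfl

theorem fockEval_s (e : E₁) :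
    fockEval φ S (ToeplitzAlgebra.s S e) = (fockKernel E φ).op (createPEquiv e) := rfl

theorem star_fockEval_p (w : V) : star (fockEval φ S (ToeplitzAlgebra.p S w)) =
    (fockKernel E φ).op (S.actPEquiv (𝟙 w)) := by
  rw [ToeplitzAlgebra.p, fockEval_u, PosKernel.star_op (admissible_act φ S _), actPEquiv_symm,
    Groupoid.inv_eq_inv, IsIso.inv_id]

/-- Adjoints of creation operators strip edges: s_l^* removes the prefix l, and by the next lemma it
annihilates vectors whose path does not start with l. -/
theorem star_fockEval_sList_append (l m : List E₁) (w : V) (h : E.IsPathFrom w (l ++ m))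
    (h' : E.IsPathFrom (E.listSource w l) m) :
    star (fockEval φ S (ToeplitzAlgebra.sList S w l))
        ((fockKernel E φ).vec (unitIndex E w ⟨l ++ m, h⟩)) =
      (fockKernel E φ).vec (unitIndex E (E.listSource w l) ⟨m, h'⟩) := by
  induction l generalizing w with
  | nil =>
    rw [ToeplitzAlgebra.sList, star_fockEval_p]
    exact op_act_id_vec φ S (unitIndex E w ⟨m, h⟩)
  | cons e l ih =>
    rw [ToeplitzAlgebra.sList, map_mul, star_mul, mul_apply_eq_comp, fockEval_s,
      star_op_create_vec]
    have h1 : removeFun e (unitIndex E w ⟨e :: l ++ m, h⟩) =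
        some (unitIndex E (E.s e) ⟨l ++ m, h.2⟩) := if_pos rfl
    rw [h1, Option.elim_some]
    exact ih (E.s e) h.2 h'

theorem star_fockEval_sList_ne (l : List E₁) (w : V) (hl : E.IsPathFrom w l) (i : FockIndex E)
    (h : ¬ (i.range = w ∧ l <+: i.path.1)) :
    star (fockEval φ S (ToeplitzAlgebra.sList S w l)) ((fockKernel E φ).vec i) = 0 := by
  induction l generalizing w i with
  | nil =>
    rw [ToeplitzAlgebra.sList, star_fockEval_p]
    exact op_act_vec_ne φ S _ fun hi => h ⟨hi, List.nil_prefix⟩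
  | cons e l ih =>
    rw [ToeplitzAlgebra.sList, map_mul, star_mul, mul_apply_eq_comp, fockEval_s,
      star_op_create_vec]
    induction i using FockIndex.rec_path with
    | nil => rw [removeFun_vertexPath, Option.elim_none, map_zero]
    | cons f μ z k =>
      by_cases hf : f = e
      · subst hf
        rw [removeFun_consPath_self, Option.elim_some]
        refine ih (E.s f) hl.2 _ fun h' => h ⟨hl.1, ?_⟩
        exact (List.cons_prefix_cons).2 ⟨rfl, h'.2⟩
      · rw [removeFun_consPath_ne hf, Option.elim_none, map_zero]

/-- The vector functional of the Fock representation at a path. -/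
def pathFunctional (w : V) (μ : E.Path w) : ToeplitzAlgebra S →ₗ[ℂ] ℂ where
  toFun a := inner ℂ ((fockKernel E φ).vec (unitIndex E w μ))
    (fockEval φ S a ((fockKernel E φ).vec (unitIndex E w μ)))
  map_add' a b := by rw [map_add, add_apply, inner_add_right]
  map_smul' c a := by rw [map_smul, smul_apply, inner_smul_right]; rfl

theorem pathFunctional_one (w : V) (μ : E.Path w) :
    pathFunctional φ S w μ 1 = φ (GroupoidCStar.u (𝟙 μ.source)) := by
  change inner ℂ _ (fockEval φ S 1 _) = _
  rw [map_one]
  exact inner_unitIndex φ w μ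

open scoped ComplexOrder in
theorem pathFunctional_nonneg (w : V) (μ : E.Path w) (a : ToeplitzAlgebra S) :
    0 ≤ pathFunctional φ S w μ (star a * a) := by
  change 0 ≤ inner ℂ _ (fockEval φ S (star a * a) _)
  rw [map_mul, map_star, mul_apply_eq_comp, ContinuousLinearMap.star_eq_adjoint,
    ContinuousLinearMap.adjoint_inner_right, inner_self_eq_norm_sq_to_K]
  exact (Complex.zero_le_real.2 (sq_nonneg _)).trans_eq (Complex.ofReal_pow _ _)

/-- Cauchy–Schwarz bounds a positive functional by its value at 1; here that value is the
contribution of μ to the partition function. -/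
theorem pathFunctional_norm_le (w : V) (μ : E.Path w) (a : ToeplitzAlgebra S) :
    ‖pathFunctional φ S w μ a‖ ≤ ‖a‖ * (φ (GroupoidCStar.u (𝟙 μ.source))).re := by
  rw [← inner_unitIndex φ w μ]
  change ‖inner ℂ _ (fockEval φ S a _)‖ ≤ ‖a‖ * RCLike.re (inner ℂ _ _)
  rw [inner_self_eq_norm_sq]
  generalize (fockKernel E φ).vec (unitIndex E w μ) = ξ
  have h1 : ‖fockEval φ S a‖ ≤ ‖a‖ := NonUnitalStarAlgHom.norm_apply_le (fockEval φ S) a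
  calc _ ≤ ‖ξ‖ * ‖fockEval φ S a ξ‖ := norm_inner_le_norm _ _
    _ ≤ ‖ξ‖ * (‖fockEval φ S a‖ * ‖ξ‖) := by gcongr; exact ContinuousLinearMap.le_opNorm _ _
    _ ≤ ‖ξ‖ * (‖a‖ * ‖ξ‖) := by gcongr
    _ = ‖a‖ * ‖ξ‖ ^ 2 := by ring

theorem pathFunctional_monomial {w w' v : V} (μ : E.Path w) (ν : E.Path w')
    (g : ν.source ⟶ μ.source) (l : E.Path v) :
    pathFunctional φ S v l (ToeplitzAlgebra.sPath S μ * ToeplitzAlgebra.u S g *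
        star (ToeplitzAlgebra.sPath S ν)) =
      inner ℂ (star (fockEval φ S (ToeplitzAlgebra.sList S w μ.1))
          ((fockKernel E φ).vec (unitIndex E v l)))
        ((fockKernel E φ).op (S.actPEquiv g)
          (star (fockEval φ S (ToeplitzAlgebra.sList S w' ν.1))
            ((fockKernel E φ).vec (unitIndex E v l)))) := by
  change inner ℂ _ (fockEval φ S _ _) = _
  rw [map_mul, map_mul, map_star, mul_apply_eq_comp, mul_apply_eq_comp, fockEval_u,
    ContinuousLinearMap.star_eq_adjoint]
  exact (ContinuousLinearMap.adjoint_inner_left _ _ _).symm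

/-- A nonzero value requires l = μm = νn with m = g·n. The action preserves length, so |m| = |n|,
and then μ and ν are prefixes of l of equal length, hence equal. -/
theorem pathFunctional_monomial_ne {w w' v : V} (μ : E.Path w) (ν : E.Path w')
    (g : ν.source ⟶ μ.source) (hμν : (⟨w, μ⟩ : Σ v, E.Path v) ≠ ⟨w', ν⟩) (l : E.Path v) :
    pathFunctional φ S v l (ToeplitzAlgebra.sPath S μ * ToeplitzAlgebra.u S g *
        star (ToeplitzAlgebra.sPath S ν)) = 0 := by
  rw [pathFunctional_monomial]
  by_cases h1 : (unitIndex E v l).range = w ∧ μ.1 <+: (unitIndex E v l).path.1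
  · by_cases h2 : (unitIndex E v l).range = w' ∧ ν.1 <+: (unitIndex E v l).path.1
    · obtain ⟨rfl, m, hm⟩ := h1
      obtain ⟨rfl, n, hn⟩ := h2
      obtain ⟨l, hl⟩ := l
      obtain ⟨μ, hμ⟩ := μ
      obtain ⟨ν, hν⟩ := ν
      change μ ++ m = l at hm
      change ν ++ n = l at hn
      have hp : ∀ (a b : List E₁) (x : V), E.IsPathFrom x (a ++ b) →
          E.IsPathFrom (E.listSource x a) b := by
        intro a
        induction a with
        | nil => exact fun _ _ h => h
        | cons e a ih => exact fun b x h => ih b _ h.2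
      have e1 : star (fockEval φ S (ToeplitzAlgebra.sList S v μ))
          ((fockKernel E φ).vec (unitIndex E v ⟨l, hl⟩)) =
          (fockKernel E φ).vec (unitIndex E (E.listSource v μ) ⟨m, hp μ m v (hm ▸ hl)⟩) := by
        subst hm
        exact star_fockEval_sList_append φ S μ m v hl _
      have e2 : star (fockEval φ S (ToeplitzAlgebra.sList S v ν))
          ((fockKernel E φ).vec (unitIndex E v ⟨l, hl⟩)) =
          (fockKernel E φ).vec (unitIndex E (E.listSource v ν) ⟨n, hp ν n v (hn ▸ hl)⟩) := by
        subst hn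
        exact star_fockEval_sList_append φ S ν n v hl _
      refine (congrArg₂ (inner ℂ) e1 (congrArg _ e2)).trans ?_
      refine (congrArg (inner ℂ _) (op_act_vec_self φ S g _ _ _)).trans ?_
      rw [PosKernel.inner_vec]
      refine fockKernel_of_key_ne φ fun he => hμν ?_
      have h3 : m.length = n.length := by
        have h4 := congrArg (fun q : Σ x : V, E.Path x => q.2.1.length) he
        exact h4.trans (S.length_act g _)
      have h5 : μ = ν := (List.append_inj' (hm.trans hn.symm) h3).1
      subst h5
      rfl
    · refine (congrArg (inner ℂ _) ?_).trans (inner_zero_right _)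
      rw [star_fockEval_sList_ne φ S ν.1 w' ν.2 _ h2, map_zero]
  · rw [star_fockEval_sList_ne φ S μ.1 w μ.2 _ h1, inner_zero_left]

open Classical in
theorem sum_pathFunctional_monomial {w : V} (μ : E.Path w) (g : μ.source ⟶ μ.source) (j : ℕ) :
    ∑ v : V, ∑ l : E.PathN v (μ.length + j), pathFunctional φ S v l.1
        (ToeplitzAlgebra.sPath S μ * ToeplitzAlgebra.u S g * star (ToeplitzAlgebra.sPath S μ)) =
      ∑ l : E.PathN μ.source j with S.act g l.1 = l.1, φ (GroupoidCStar.u (S.restr g l.1)) := by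
  have hzero : ∀ (v : V) (l : E.Path v), ¬ (v = w ∧ μ.1 <+: l.1) → pathFunctional φ S v l
      (ToeplitzAlgebra.sPath S μ * ToeplitzAlgebra.u S g * star (ToeplitzAlgebra.sPath S μ)) =
        0 := by
    intro v l h
    rw [pathFunctional_monomial, star_fockEval_sList_ne φ S μ.1 w μ.2 (unitIndex E v l) h,
      inner_zero_left]
  rw [Finset.sum_eq_single w]
  -- Extended by zero to lists that are not paths, the functional vanishes off the extensions of μ,
  -- and the sum collapses to the remainders λ of l = μλ.
  · let F : List E₁ → ℂ := fun l => if h : E.IsPathFrom w l then pathFunctional φ S w ⟨l, h⟩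
      (ToeplitzAlgebra.sPath S μ * ToeplitzAlgebra.u S g * star (ToeplitzAlgebra.sPath S μ)) else 0
    have hF : ∀ l : E.Path w, F l.1 = pathFunctional φ S w l
      (ToeplitzAlgebra.sPath S μ * ToeplitzAlgebra.u S g * star (ToeplitzAlgebra.sPath S μ)) :=
      fun l => dif_pos l.2
    have h1 := sum_pathN_prefix E F μ.1 w μ.2 j fun m hm => by
      by_cases h : E.IsPathFrom w m
      · exact (hF ⟨m, h⟩).trans (hzero w ⟨m, h⟩ fun h' => hm h'.2)
      · exact dif_neg h
    simp only [hF] at h1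
    refine h1.trans ?_
    rw [Finset.sum_filter]
    refine Finset.sum_congr rfl fun l _ => ?_
    refine (hF (μ.append l.1)).trans ?_
    rw [pathFunctional_monomial]
    have e1 := star_fockEval_sList_append φ S μ.1 l.1.1 w (μ.append l.1).2 l.1.2
    refine (congrArg₂ (inner ℂ) e1 (congrArg _ e1)).trans ?_
    exact inner_unitIndex_op_act φ S g l.1
  · intro v _ hv
    exact Finset.sum_eq_zero fun l _ => hzero v l.1 fun h => hv h.1
  · intro h
    exact absurd (Finset.mem_univ w) h

theorem sum_pathFunctional_monomial_lt {w : V} (μ : E.Path w) (g : μ.source ⟶ μ.source) {k : ℕ}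
    (hk : k < μ.length) :
    ∑ v : V, ∑ l : E.PathN v k, pathFunctional φ S v l.1
        (ToeplitzAlgebra.sPath S μ * ToeplitzAlgebra.u S g * star (ToeplitzAlgebra.sPath S μ)) =
      0 := by
  refine Finset.sum_eq_zero fun v _ => Finset.sum_eq_zero fun l _ => ?_
  rw [pathFunctional_monomial, star_fockEval_sList_ne φ S μ.1 w μ.2 (unitIndex E v l.1),
    inner_zero_left]
  intro h
  have h1 := h.2.length_le
  have h2 : l.1.1.length = k := l.2
  change μ.1.length ≤ l.1.1.length at h1
  change k < μ.1.length at hk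
  omega

end PsiState

/-! ### Construction of the state -/

section PsiState

variable {V E₁ : Type u} [Fintype V] [Fintype E₁] [Groupoid.{u} V] {E : DirectedGraph V E₁}

/-- The contribution of the paths of length `k` to the (unnormalised) state `Ψ_{β,τ}`. -/
def psiTerm (S : SelfSimilarAction E) (β : ℝ) (τ : TracialState (GroupoidCStar V))
    (a : ToeplitzAlgebra S) (k : ℕ) : ℂ :=
  (Real.exp (-(β * k)) : ℂ) *
    ∑ v : V, ∑ l : E.PathN v k, pathFunctional τ.toCState S v l.1 a

variable (S : SelfSimilarAction E) (β : ℝ) (τ : TracialState (GroupoidCStar V))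

theorem psiTerm_norm_le (a : ToeplitzAlgebra S) (k : ℕ) :
    ‖psiTerm S β τ a k‖ ≤ ‖a‖ * partitionTerm E β τ k := by
  rw [psiTerm, partitionTerm, norm_mul, Complex.norm_real, Real.norm_of_nonneg (Real.exp_pos _).le,
    mul_left_comm, Finset.mul_sum]
  gcongr
  refine (norm_sum_le _ _).trans (Finset.sum_le_sum fun v _ => ?_)
  rw [Finset.mul_sum]
  refine (norm_sum_le _ _).trans (Finset.sum_le_sum fun l _ => ?_)
  exact pathFunctional_norm_le τ.toCState S v l.1 a

theorem psiTerm_one (k : ℕ) : psiTerm S β τ 1 k = (partitionTerm E β τ k : ℂ) := by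
  rw [psiTerm, partitionTerm, Complex.ofReal_mul, Complex.ofReal_sum]
  congr 1
  refine Finset.sum_congr rfl fun v _ => ?_
  rw [Complex.ofReal_sum]
  refine Finset.sum_congr rfl fun l _ => ?_
  rw [pathFunctional_one, coe_vertexVector]

open scoped ComplexOrder in
theorem psiTerm_nonneg (a : ToeplitzAlgebra S) (k : ℕ) : 0 ≤ psiTerm S β τ (star a * a) k :=
  mul_nonneg (Complex.zero_le_real.2 (Real.exp_pos _).le)
    (Finset.sum_nonneg fun _ _ => Finset.sum_nonneg fun _ _ => pathFunctional_nonneg _ S _ _ a)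

theorem psiTerm_add (a b : ToeplitzAlgebra S) (k : ℕ) :
    psiTerm S β τ (a + b) k = psiTerm S β τ a k + psiTerm S β τ b k := by
  simp only [psiTerm, map_add, Finset.sum_add_distrib, mul_add]

theorem psiTerm_smul (c : ℂ) (a : ToeplitzAlgebra S) (k : ℕ) :
    psiTerm S β τ (c • a) k = c * psiTerm S β τ a k := by
  simp only [psiTerm, map_smul, smul_eq_mul, ← Finset.mul_sum]
  ring

variable {β τ}

theorem summable_psiTerm (hs : Summable (partitionTerm E β τ)) (a : ToeplitzAlgebra S) :
    Summable (psiTerm S β τ a) :=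
  Summable.of_norm_bounded (hs.mul_left ‖a‖) (psiTerm_norm_le S β τ a)

variable (hs : Summable (partitionTerm E β τ)) (hZ : 0 < partitionFunction E β τ)

open scoped ComplexOrder in
/-- The state `Ψ_{β,τ}` of the Toeplitz algebra. -/
def psiState : CState (ToeplitzAlgebra S) where
  toLinearMap :=
    { toFun := fun a => (partitionFunction E β τ : ℂ)⁻¹ * ∑' k, psiTerm S β τ a k
      map_add' := fun a b => by
        simp only [psiTerm_add]
        rw [(summable_psiTerm S hs a).tsum_add (summable_psiTerm S hs b), mul_add]
      map_smul' := fun c a => by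
        simp only [psiTerm_smul, tsum_mul_left, RingHom.id_apply, smul_eq_mul]
        ring }
  nonneg a := by
    refine mul_nonneg ?_ (tsum_nonneg (psiTerm_nonneg S β τ a))
    rw [← Complex.ofReal_inv]
    exact Complex.zero_le_real.2 (inv_pos.2 hZ).le
  map_one := by
    change (partitionFunction E β τ : ℂ)⁻¹ * ∑' k, psiTerm S β τ 1 k = 1
    simp only [psiTerm_one]
    rw [← Complex.ofReal_tsum]
    exact inv_mul_cancel₀ (Complex.ofReal_ne_zero.2 hZ.ne')

theorem psiState_apply (a : ToeplitzAlgebra S) :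
    psiState S hs hZ a = (partitionFunction E β τ : ℂ)⁻¹ * ∑' k, psiTerm S β τ a k := rfl

/-- Paths μλ with |λ| = j have length j + |μ|, which produces the factor e^{-β|μ|}. -/
theorem psiTerm_monomial_add {w : V} (μ : E.Path w) (g : μ.source ⟶ μ.source) (j : ℕ) :
    psiTerm S β τ (ToeplitzAlgebra.sPath S μ * ToeplitzAlgebra.u S g *
      star (ToeplitzAlgebra.sPath S μ)) (j + μ.length) =
      (Real.exp (-(β * μ.length)) : ℂ) * fixedTerm S β τ g j := by
  rw [psiTerm, Nat.add_comm, sum_pathFunctional_monomial, fixedTerm, ← mul_assoc,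
    ← Complex.ofReal_mul, ← Real.exp_add, Nat.cast_add, mul_add, neg_add]

theorem psiTerm_monomial_lt {w : V} (μ : E.Path w) (g : μ.source ⟶ μ.source) {k : ℕ}
    (hk : k < μ.length) :
    psiTerm S β τ (ToeplitzAlgebra.sPath S μ * ToeplitzAlgebra.u S g *
      star (ToeplitzAlgebra.sPath S μ)) k = 0 := by
  rw [psiTerm, sum_pathFunctional_monomial_lt _ _ _ _ hk, mul_zero]

theorem isPsi_psiState : IsPsi S β τ (psiState S hs hZ) where
  summable {v} g := by
    have h := (summable_nat_add_iff 0).2 (summable_psiTerm S hs (ToeplitzAlgebra.sPath S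
      (E.vertexPath v) * ToeplitzAlgebra.u S g * star (ToeplitzAlgebra.sPath S (E.vertexPath v))))
    -- For a path of length zero the shift is by 0, and the terms of Ψ are the fixed-path terms up
    -- to a nonzero constant.
    have h2 := fun j => psiTerm_monomial_add (β := β) (τ := τ) S (E.vertexPath v) g j
    have h3 := h.congr h2
    rwa [summable_mul_left_iff (Complex.ofReal_ne_zero.2 (Real.exp_pos _).ne')] at h3
  diag {w} μ g := by
    -- The first |μ| terms vanish, since shorter paths cannot start with μ.
    rw [psiState_apply, ← (summable_psiTerm S hs _).sum_add_tsum_nat_add μ.length,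
      Finset.sum_eq_zero fun k hk => psiTerm_monomial_lt S μ g (Finset.mem_range.1 hk), zero_add]
    simp only [psiTerm_monomial_add, tsum_mul_left]
    ring
  offDiag {w w'} μ ν g h := by
    rw [psiState_apply]
    have h1 : ∀ k, psiTerm S β τ (ToeplitzAlgebra.sPath S μ * ToeplitzAlgebra.u S g *
        star (ToeplitzAlgebra.sPath S ν)) k = 0 := by
      intro k
      rw [psiTerm]
      simp only [pathFunctional_monomial_ne τ.toCState S μ ν g h, Finset.sum_const_zero, mul_zero]
    simp only [h1, tsum_zero, mul_zero]

end PsiState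

/-! ### Consequences of the Toeplitz relations -/

section Uniqueness

variable {V E₁ : Type u} [Fintype V] [Fintype E₁] [Groupoid.{u} V] {E : DirectedGraph V E₁}

namespace ToeplitzRep

variable {S : SelfSimilarAction E} (ρ : ToeplitzRep S)

theorem v_id_mul_t (e : E₁) : ρ.v (𝟙 (E.r e)) * ρ.t e = ρ.t e := by
  have h := congrArg (· * ρ.t e) ρ.sum_v
  simp only [Finset.sum_mul, one_mul] at h
  rwa [Finset.sum_eq_single (E.r e) (fun w _ hw => ρ.v_mul_t_eq_zero _ _ hw)
    (fun h => absurd (Finset.mem_univ _) h)] at h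

theorem norm_t_apply (e : E₁) (x : ρ.H) : ‖ρ.t e x‖ = ‖ρ.v (𝟙 (E.s e)) x‖ := by
  have h1 : ‖ρ.t e x‖ ^ 2 = RCLike.re (inner ℂ x (ρ.v (𝟙 (E.s e)) x)) := by
    rw [← ρ.star_t_mul_t, mul_apply_eq_comp, ContinuousLinearMap.star_eq_adjoint,
      ContinuousLinearMap.adjoint_inner_right, inner_self_eq_norm_sq]
  have h2 : ‖ρ.v (𝟙 (E.s e)) x‖ ^ 2 = RCLike.re (inner ℂ x (ρ.v (𝟙 (E.s e)) x)) := by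
    have h3 := congrArg (fun T => RCLike.re (inner ℂ x (T x))) (ρ.star_v_mul_v (𝟙 (E.s e)))
    simp only [mul_apply_eq_comp, ContinuousLinearMap.star_eq_adjoint,
      ContinuousLinearMap.adjoint_inner_right, inner_self_eq_norm_sq] at h3
    exact h3
  exact (sq_eq_sq₀ (norm_nonneg _) (norm_nonneg _)).1 (h1.trans h2.symm)

/-- As ‖t_e y‖ = ‖v y‖ for the projection v at s(e), t_e kills the kernel of v, in particular v x -
x. -/
theorem t_mul_v_id (e : E₁) : ρ.t e * ρ.v (𝟙 (E.s e)) = ρ.t e := by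
  refine ContinuousLinearMap.ext fun x => ?_
  have h := ρ.norm_t_apply e (ρ.v (𝟙 (E.s e)) x - x)
  have hv := congrArg (fun T => T x) (ρ.v_mul (𝟙 (E.s e)) (𝟙 (E.s e)))
  simp only [Category.comp_id, mul_apply_eq_comp] at hv
  rw [map_sub, map_sub, hv, sub_self, norm_zero, norm_eq_zero, sub_eq_zero] at h
  exact h

/-- For edges with the same range, evaluate Σ t_d t_d^* ≤ v at y = t_f x: the term d = f already
gives ‖y‖², the full bound, so ‖t_e^* y‖² must be 0. Edges with different ranges are separated by
the orthogonal units. -/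
theorem star_t_mul_t_of_ne {e f : E₁} (hef : e ≠ f) : star (ρ.t e) * ρ.t f = 0 := by
  classical
  by_cases hr : E.r e = E.r f
  · refine ContinuousLinearMap.ext fun x => ?_
    have h := ρ.sum_t_mul_star_t_le (E.r f)
    rw [ContinuousLinearMap.le_def] at h
    have h1 := h.re_inner_nonneg_right (ρ.t f x)
    have hterm : ∀ e : E₁, RCLike.re (inner ℂ (ρ.t f x) ((ρ.t e * star (ρ.t e)) (ρ.t f x))) =
        ‖star (ρ.t e) (ρ.t f x)‖ ^ 2 := by
      intro e
      rw [mul_apply_eq_comp, ContinuousLinearMap.star_eq_adjoint,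
        ← ContinuousLinearMap.adjoint_inner_left, inner_self_eq_norm_sq]
    have hv : ρ.v (𝟙 (E.r f)) (ρ.t f x) = ρ.t f x :=
      congrArg (fun T => T x) (ρ.v_id_mul_t f)
    rw [sub_apply, inner_sub_right, map_sub, hv, inner_self_eq_norm_sq, sum_apply, inner_sum,
      map_sum, Finset.sum_congr rfl fun e _ => hterm e] at h1
    have hf : ‖star (ρ.t f) (ρ.t f x)‖ = ‖ρ.t f x‖ := by
      rw [ρ.norm_t_apply, ← ρ.star_t_mul_t]
      rfl
    have h2 : ‖star (ρ.t e) (ρ.t f x)‖ ^ 2 + ‖star (ρ.t f) (ρ.t f x)‖ ^ 2 ≤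
        ∑ e : E₁ with E.r e = E.r f, ‖star (ρ.t e) (ρ.t f x)‖ ^ 2 := by
      rw [← Finset.sum_pair (f := fun e => ‖star (ρ.t e) (ρ.t f x)‖ ^ 2) hef]
      refine Finset.sum_le_sum_of_subset_of_nonneg ?_ fun _ _ _ => sq_nonneg _
      intro d hd
      rcases Finset.mem_insert.1 hd with rfl | hd
      · exact Finset.mem_filter.2 ⟨Finset.mem_univ _, hr⟩
      · rw [Finset.mem_singleton.1 hd]
        exact Finset.mem_filter.2 ⟨Finset.mem_univ _, rfl⟩
    rw [hf] at h2
    have h3 : ‖star (ρ.t e) (ρ.t f x)‖ ^ 2 ≤ 0 := by linarith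
    exact norm_eq_zero.1 (pow_eq_zero_iff two_ne_zero |>.1 (le_antisymm h3 (sq_nonneg _)))
  · rw [← ρ.v_id_mul_t e, star_mul, ← ρ.v_inv, Groupoid.inv_eq_inv, IsIso.inv_id, mul_assoc,
      ρ.v_mul_t_eq_zero _ _ hr, mul_zero]

end ToeplitzRep

end Uniqueness

/-! ### Monomials span a dense subspace -/

namespace ToeplitzAlgebra

variable {V E₁ : Type u} [Fintype V] [Fintype E₁] [Groupoid.{u} V] {E : DirectedGraph V E₁}
  (S : SelfSimilarAction E)

theorem u_mul {x y z : V} (h : x ⟶ y) (g : y ⟶ z) : u S g * u S h = u S (h ≫ g) :=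
  ext_eval fun ρ => by rw [map_mul]; exact ρ.v_mul h g

theorem u_mul_eq_zero {x y y' z : V} (h : x ⟶ y) (g : y' ⟶ z) (hy : y' ≠ y) :
    u S g * u S h = 0 :=
  ext_eval fun ρ => by rw [map_mul, map_zero]; exact ρ.v_mul_eq_zero h g hy

theorem star_u {x y : V} (g : x ⟶ y) : star (u S g) = u S (Groupoid.inv g) :=
  ext_eval fun ρ => by rw [map_star]; exact (ρ.v_inv g).symm

theorem sum_p : ∑ w : V, p S w = 1 :=
  ext_eval fun ρ => by rw [map_sum, map_one]; exact ρ.sum_v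

theorem star_p (w : V) : star (p S w) = p S w := by
  rw [p, star_u, Groupoid.inv_eq_inv, IsIso.inv_id]

theorem star_s_mul_s (e : E₁) : star (s S e) * s S e = p S (E.s e) :=
  ext_eval fun ρ => by rw [map_mul, map_star]; exact ρ.star_t_mul_t e

theorem star_s_mul_s_of_ne {e f : E₁} (h : e ≠ f) : star (s S e) * s S f = 0 :=
  ext_eval fun ρ => by rw [map_mul, map_star, map_zero]; exact ρ.star_t_mul_t_of_ne h

theorem p_mul_s (e : E₁) : p S (E.r e) * s S e = s S e :=
  ext_eval fun ρ => by rw [map_mul]; exact ρ.v_id_mul_t e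

theorem s_mul_p (e : E₁) : s S e * p S (E.s e) = s S e :=
  ext_eval fun ρ => by rw [map_mul]; exact ρ.t_mul_v_id e

theorem u_mul_p {x y : V} (g : x ⟶ y) : u S g * p S x = u S g := by
  rw [p, u_mul, Category.id_comp]

theorem p_mul_u {x y : V} (g : x ⟶ y) : p S y * u S g = u S g := by
  rw [p, u_mul, Category.comp_id]

theorem p_mul_p (w : V) : p S w * p S w = p S w := u_mul_p S (𝟙 w)

/-- The existential form hides the transport from s(h·e) to s(f), so that later inductions meet no
dependent equalities. -/
theorem exists_u_mul_s (e : E₁) {y : V} (h : E.r e ⟶ y) :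
    ∃ f : E₁, E.r f = y ∧ ∃ k : E.s e ⟶ E.s f, u S h * s S e = s S f * u S k := by
  obtain ⟨f, hf⟩ := List.length_eq_one_iff.1 (S.length_act h (E.edgePath e))
  have h1 := (S.act h (E.edgePath e)).2
  rw [hf] at h1
  refine ⟨f, h1.1, ?_⟩
  have h2 : (S.act h (E.edgePath e)).source = E.s f := by
    change E.listSource y _ = _
    rw [hf]
    rfl
  have h3 : u S h * s S e = s S f * u S (S.restr h (E.edgePath e)) :=
    ext_eval fun ρ => by rw [map_mul, map_mul]; exact ρ.v_mul_t e f h hf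
  have h4 : ∀ (z : V) (k : E.s e ⟶ z), z = E.s f → u S h * s S e = s S f * u S k →
      ∃ k : E.s e ⟶ E.s f, u S h * s S e = s S f * u S k := by
    rintro _ k rfl hk
    exact ⟨k, hk⟩
  exact h4 _ _ h2 h3

theorem p_mul_sList (l : List E₁) (w : V) (hl : E.IsPathFrom w l) :
    p S w * sList S w l = sList S w l := by
  cases l with
  | nil => exact p_mul_p S w
  | cons e l =>
    obtain ⟨rfl, _⟩ := hl
    rw [sList, ← mul_assoc, p_mul_s]

theorem sList_append_singleton (l : List E₁) (f : E₁) (w : V) (hf : E.listSource w l = E.r f) :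
    sList S w (l ++ [f]) = sList S w l * s S f := by
  induction l generalizing w with
  | nil =>
    change w = E.r f at hf
    subst hf
    change s S f * p S (E.s f) = p S (E.r f) * s S f
    rw [s_mul_p, p_mul_s]
  | cons e l ih =>
    change s S e * sList S (E.s e) (l ++ [f]) = s S e * sList S (E.s e) l * s S f
    rw [ih (E.s e) hf, mul_assoc]

theorem exists_u_mul_sList (l : List E₁) {x y : V} (h : x ⟶ y) (hl : E.IsPathFrom x l) :
    ∃ m : List E₁, E.IsPathFrom y m ∧ ∃ k : E.listSource x l ⟶ E.listSource y m,
      u S h * sList S x l = sList S y m * u S k := by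
  induction l generalizing x y with
  | nil => exact ⟨[], trivial, h, (u_mul_p S h).trans (p_mul_u S h).symm⟩
  | cons e l ih =>
    obtain ⟨rfl, hl⟩ := hl
    obtain ⟨f, rfl, k, hk⟩ := exists_u_mul_s S e h
    obtain ⟨m, hm, k', hk'⟩ := ih k hl
    refine ⟨f :: m, ⟨rfl, hm⟩, k', ?_⟩
    rw [sList, sList, ← mul_assoc, hk, mul_assoc, hk', mul_assoc]
    rfl

/-- The elements `s_μ u_g s_ν^*` of the Toeplitz algebra. -/
def monomials : Set (ToeplitzAlgebra S) :=
  {a | ∃ (w w' : V) (l m : List E₁) (_ : E.IsPathFrom w l) (_ : E.IsPathFrom w' m) (x y : V)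
    (_ : E.listSource w' m = x) (_ : E.listSource w l = y) (g : x ⟶ y),
      a = sList S w l * u S g * star (sList S w' m)}

theorem s_mul_mem_span_monomials (e : E₁) {a : ToeplitzAlgebra S} (ha : a ∈ monomials S) :
    s S e * a ∈ Submodule.span ℂ (monomials S) := by
  obtain ⟨w, w', l, m, hl, hm, x, y, hx, hy, g, rfl⟩ := ha
  by_cases hw : w = E.s e
  · subst hw
    refine Submodule.subset_span ⟨E.r e, w', e :: l, m, ⟨rfl, hl⟩, hm, x, y, hx, hy, g, ?_⟩
    rw [sList, mul_assoc, mul_assoc, mul_assoc]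
  · rw [← p_mul_sList S l w hl, ← s_mul_p, mul_assoc, mul_assoc, mul_assoc, p, p,
      ← mul_assoc (u S _) (u S _), u_mul_eq_zero S _ _ (Ne.symm hw), zero_mul, mul_zero]
    exact Submodule.zero_mem _

theorem u_mul_mem_span_monomials {x₀ y₀ : V} (h : x₀ ⟶ y₀) {a : ToeplitzAlgebra S}
    (ha : a ∈ monomials S) : u S h * a ∈ Submodule.span ℂ (monomials S) := by
  obtain ⟨w, w', l, m, hl, hm, x, y, hx, hy, g, rfl⟩ := ha
  by_cases hw : w = x₀
  · subst hw
    subst hy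
    obtain ⟨l', hl', k, hk⟩ := exists_u_mul_sList S l h hl
    refine Submodule.subset_span ⟨y₀, w', l', m, hl', hm, x, _, hx, rfl, g ≫ k, ?_⟩
    rw [← mul_assoc, ← mul_assoc, hk, mul_assoc (sList S y₀ l'), u_mul]
  · rw [← p_mul_sList S l w hl, p, mul_assoc, mul_assoc, ← mul_assoc (u S h),
      u_mul_eq_zero S _ _ (Ne.symm hw), zero_mul]
    exact Submodule.zero_mem _

theorem star_s_mul_mem_span_monomials (e : E₁) {a : ToeplitzAlgebra S} (ha : a ∈ monomials S) :
    star (s S e) * a ∈ Submodule.span ℂ (monomials S) := by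
  obtain ⟨w, w', l, m, hl, hm, x, y, hx, hy, g, rfl⟩ := ha
  cases l with
  | nil =>
    change w = y at hy
    subst hy
    rw [sList, p_mul_u]
    by_cases hw : E.r e = w
    · subst hw
      -- Taking adjoints in u_{g⁻¹} s_e = s_f u_k gives s_e^* u_g = u_{k⁻¹} s_f^*. The annihilated
      -- edge thus passes to the right, where f is appended to m.
      obtain ⟨f, hf, k, hk⟩ := exists_u_mul_s S e (Groupoid.inv g)
      have h1 : star (s S e) * u S g = u S (Groupoid.inv k) * star (s S f) := by
        have := congrArg star hk
        rwa [star_mul, star_mul, star_u, star_u, Groupoid.inv_eq_inv (Groupoid.inv g),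
          Groupoid.inv_eq_inv g, IsIso.inv_inv] at this
      refine Submodule.subset_span ⟨E.s e, w', [], m ++ [f], trivial, ?_, E.s f, E.s e, ?_, rfl,
        Groupoid.inv k, ?_⟩
      · exact isPathFrom_append m [f] w' hm ⟨hf.trans hx.symm, trivial⟩
      · rw [listSource_append]
        rfl
      · rw [sList, p_mul_u, sList_append_singleton S m f w' (hx.trans hf.symm), star_mul,
          ← mul_assoc, ← mul_assoc, h1]
    · rw [← p_mul_u S g, ← p_mul_s S e, star_mul, star_p, p, p, mul_assoc, mul_assoc,
        ← mul_assoc (u S _) (u S _), u_mul_eq_zero S _ _ hw, zero_mul, mul_zero]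
      exact Submodule.zero_mem _
  | cons f l =>
    rw [sList, ← mul_assoc, ← mul_assoc, ← mul_assoc]
    by_cases hf : e = f
    · subst hf
      rw [star_s_mul_s, p_mul_sList S l _ hl.2]
      exact Submodule.subset_span ⟨E.s e, w', l, m, hl.2, hm, x, y, hx, hy, g, rfl⟩
    · rw [star_s_mul_s_of_ne S hf, zero_mul, zero_mul, zero_mul]
      exact Submodule.zero_mem _

theorem mul_mem_span_of_forall_mem {A : Type*} [CStarAlgebra A] {X : Set A} {b : A}
    (h : ∀ a ∈ X, b * a ∈ Submodule.span ℂ X) {a : A} (ha : a ∈ Submodule.span ℂ X) :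
    b * a ∈ Submodule.span ℂ X := by
  induction ha using Submodule.span_induction with
  | mem a ha => exact h a ha
  | zero => rw [mul_zero]; exact Submodule.zero_mem _
  | add a b _ _ ha hb => rw [mul_add]; exact Submodule.add_mem _ ha hb
  | smul c a _ ha => rw [mul_smul_comm]; exact Submodule.smul_mem _ _ ha

/-- The elements `s_μ u_g s_ν^*` span a dense subspace. -/
theorem dense_span_monomials :
    Dense (Submodule.span ℂ (monomials S) : Set (ToeplitzAlgebra S)) := by
  refine GeneratedCStar.dense_of_mul_mem _ ?_ ?_ ?_
  · rw [← sum_p S]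
    refine Submodule.sum_mem _ fun w _ => Submodule.subset_span
      ⟨w, w, [], [], trivial, trivial, w, w, rfl, rfl, 𝟙 w, ?_⟩
    rw [sList, star_p, ← p, p_mul_p, p_mul_p]
  · rintro _ (⟨x, y, g, rfl⟩ | ⟨e, rfl⟩) a ha
    · exact mul_mem_span_of_forall_mem (fun a ha => u_mul_mem_span_monomials S g ha) ha
    · exact mul_mem_span_of_forall_mem (fun a ha => s_mul_mem_span_monomials S e ha) ha
  · rintro _ (⟨x, y, g, rfl⟩ | ⟨e, rfl⟩) a ha
    · change star (u S g) * a ∈ _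
      rw [star_u]
      exact mul_mem_span_of_forall_mem (fun a ha => u_mul_mem_span_monomials S _ ha) ha
    · exact mul_mem_span_of_forall_mem (fun a ha => star_s_mul_mem_span_monomials S e ha) ha

end ToeplitzAlgebra

theorem l1Norm_smul {V : Type u} [Fintype V] (c : ℝ) (y : V → ℝ) :
    l1Norm (c • y) = |c| * l1Norm y := by
  simp [l1Norm, abs_mul, Finset.mul_sum]

/-! ### Uniqueness, the trace property and iteration -/

section Main

variable {V E₁ : Type u} [Fintype V] [Fintype E₁] [Groupoid.{u} V] {E : DirectedGraph V E₁}
  {S : SelfSimilarAction E} {β : ℝ} {τ : TracialState (GroupoidCStar V)}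

theorem IsPsi.unique {Ψ Ψ' : CState (ToeplitzAlgebra S)} (h : IsPsi S β τ Ψ)
    (h' : IsPsi S β τ Ψ') : Ψ = Ψ' := by
  refine CState.ext fun a => congrFun (Ψ.continuous.ext_on
    (ToeplitzAlgebra.dense_span_monomials S) Ψ'.continuous (LinearMap.eqOn_span ?_)) a
  rintro _ ⟨w, w', l, m, hl, hm, _, _, rfl, rfl, g, rfl⟩
  by_cases hne : (⟨w, ⟨l, hl⟩⟩ : Σ v, E.Path v) = ⟨w', ⟨m, hm⟩⟩
  · cases hne
    exact (h.diag ⟨l, hl⟩ g).trans (h'.diag ⟨l, hl⟩ g).symm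
  · exact (h.offDiag ⟨l, hl⟩ ⟨m, hm⟩ g hne).trans (h'.offDiag ⟨l, hl⟩ ⟨m, hm⟩ g hne).symm

theorem IsPsi.apply_u {Ψ : CState (ToeplitzAlgebra S)} (h : IsPsi S β τ Ψ) {v : V} (g : v ⟶ v) :
    Ψ (ToeplitzAlgebra.u S g) =
      (partitionFunction E β τ : ℂ)⁻¹ * ∑' k, fixedTerm S β τ g k := by
  have h1 := h.diag (E.vertexPath v) g
  have h2 : ToeplitzAlgebra.sPath S (E.vertexPath v) * ToeplitzAlgebra.u S g *
      star (ToeplitzAlgebra.sPath S (E.vertexPath v)) = ToeplitzAlgebra.u S g := by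
    change ToeplitzAlgebra.p S v * _ * star (ToeplitzAlgebra.p S v) = _
    rw [ToeplitzAlgebra.star_p, ToeplitzAlgebra.p_mul_u, ToeplitzAlgebra.u_mul_p]
  have h3 : (E.vertexPath v).length = 0 := rfl
  refine ((congrArg Ψ.toLinearMap h2).symm.trans h1).trans ?_
  rw [h3, Nat.cast_zero, mul_zero, neg_zero, Real.exp_zero, Complex.ofReal_one, one_mul]
  rfl

theorem IsPsi.apply_u_of_ne {Ψ : CState (ToeplitzAlgebra S)} (h : IsPsi S β τ Ψ) {v w : V}
    (g : v ⟶ w) (hne : v ≠ w) : Ψ (ToeplitzAlgebra.u S g) = 0 := by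
  have h1 := h.offDiag (E.vertexPath w) (E.vertexPath v) g fun he => hne (Sigma.mk.inj he).1.symm
  have h2 : ToeplitzAlgebra.sPath S (E.vertexPath w) * ToeplitzAlgebra.u S g *
      star (ToeplitzAlgebra.sPath S (E.vertexPath v)) = ToeplitzAlgebra.u S g := by
    change ToeplitzAlgebra.p S w * _ * star (ToeplitzAlgebra.p S v) = _
    rw [ToeplitzAlgebra.star_p, ToeplitzAlgebra.p_mul_u, ToeplitzAlgebra.u_mul_p]
  exact (congrArg Ψ.toLinearMap h2).symm.trans h1

/-- Fixed points of `hg` and `gh` of a given length contribute equally. -/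
theorem fixedTerm_comm {x y : V} (g : x ⟶ y) (h : y ⟶ x) (k : ℕ) :
    fixedTerm S β τ (g ≫ h) k = fixedTerm S β τ (h ≫ g) k := by
  classical
  unfold fixedTerm
  congr 1
  have hmem : ∀ {x y : V} (g : x ⟶ y) (h : y ⟶ x) (l : E.PathN x k),
      S.act (g ≫ h) l.1 = l.1 → S.act (h ≫ g) (S.act g l.1) = S.act g l.1 := by
    intro x y g h l hl
    rw [act_comp] at hl ⊢
    rw [hl]
  -- Fixed paths of `g ≫ h` go to fixed paths of `h ≫ g` under g, with inverse h.
  refine Finset.sum_bij'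
    (fun l _ => (⟨S.act g l.1, (S.length_act g l.1).trans l.2⟩ : E.PathN y k))
    (fun l _ => (⟨S.act h l.1, (S.length_act h l.1).trans l.2⟩ : E.PathN x k)) ?_ ?_ ?_ ?_ ?_
  · intro l hl
    exact Finset.mem_filter.2 ⟨Finset.mem_univ _, hmem g h l (Finset.mem_filter.1 hl).2⟩
  · intro l hl
    exact Finset.mem_filter.2 ⟨Finset.mem_univ _, hmem h g l (Finset.mem_filter.1 hl).2⟩
  · intro l hl
    exact Subtype.ext ((S.act_comp g h l.1).symm.trans (Finset.mem_filter.1 hl).2)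
  · intro l hl
    exact Subtype.ext ((S.act_comp h g l.1).symm.trans (Finset.mem_filter.1 hl).2)
  · intro l hl
    have hl := (Finset.mem_filter.1 hl).2
    rw [act_comp] at hl
    have hu : ∀ {a b b' : V} (k : a ⟶ b) (k' : a ⟶ b'), b = b' → HEq k k' →
        GroupoidCStar.u k = GroupoidCStar.u k' := by
      rintro a b _ k k' rfl hk
      rw [eq_of_heq hk]
    have e1 : GroupoidCStar.u (S.restr (g ≫ h) l.1) =
        GroupoidCStar.u (S.restr h (S.act g l.1)) * GroupoidCStar.u (S.restr g l.1) := by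
      rw [GroupoidCStar.u_mul]
      exact hu _ _ (by rw [act_comp]) (S.restr_comp_heq g h l.1)
    have hr : ∀ l' : E.Path x, l' = l.1 → GroupoidCStar.u (S.restr g l') =
        GroupoidCStar.u (S.restr g l.1) := by
      rintro _ rfl
      rfl
    -- The type of the restriction depends on the path, so h·(g·l) = l is used by generalising the
    -- path.
    have hr' : ∀ (l' : E.Path x), l' = l.1 → ∀ (z : V) (k : z ⟶ l'.source),
        GroupoidCStar.u (S.restr g l') * GroupoidCStar.u k =
        GroupoidCStar.u (S.restr g l.1) * GroupoidCStar.u k := by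
      rintro _ rfl z k
      rfl
    have e2 : GroupoidCStar.u (S.restr (h ≫ g) (S.act g l.1)) =
        GroupoidCStar.u (S.restr g l.1) * GroupoidCStar.u (S.restr h (S.act g l.1)) := by
      rw [← hr' _ hl, GroupoidCStar.u_mul]
      exact hu _ _ (by rw [act_comp]) (S.restr_comp_heq h g (S.act g l.1))
    rw [e1, e2]
    exact τ.tracial _ _

/-- The restriction of `Ψ_{β,τ}` to the groupoid algebra. -/
def restrictState (Ψ : CState (ToeplitzAlgebra S)) : CState (GroupoidCStar V) where
  toLinearMap := Ψ.toLinearMap ∘ₗ (incl S).toAlgHom.toLinearMap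
  nonneg a := by
    have h := Ψ.nonneg (incl S a)
    rw [← map_star, ← map_mul] at h
    exact h
  map_one := by
    refine (congrArg Ψ.toLinearMap (map_one (incl S))).trans Ψ.map_one

/-- If both products of two generators exist, they are loops and the fixed-path sums agree. If only
one exists, it is not a loop and Ψ vanishes on it. -/
theorem IsPsi.tracial_restrict {Ψ : CState (ToeplitzAlgebra S)} (h : IsPsi S β τ Ψ) :
    ∀ a b, restrictState Ψ (a * b) = restrictState Ψ (b * a) := by
  have hu : ∀ {x y : V} (g : x ⟶ y),
      restrictState Ψ (GroupoidCStar.u g) = Ψ (ToeplitzAlgebra.u S g) := fun g => rfl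
  refine GroupoidCStar.tracial_of_generators _ fun {x y x' y'} g g' => ?_
  by_cases h1 : x = y'
  · subst h1
    rw [GroupoidCStar.u_mul]
    by_cases h2 : x' = y
    · subst h2
      rw [GroupoidCStar.u_mul, hu, hu, h.apply_u, h.apply_u]
      simp only [fixedTerm_comm g' g]
    · rw [GroupoidCStar.u_mul_eq_zero _ _ h2, map_zero, hu, h.apply_u_of_ne _ h2]
  · rw [GroupoidCStar.u_mul_eq_zero _ _ h1, map_zero]
    by_cases h2 : x' = y
    · subst h2
      rw [GroupoidCStar.u_mul, hu, h.apply_u_of_ne _ h1]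
    · rw [GroupoidCStar.u_mul_eq_zero _ _ h2, map_zero]

/-- The restriction of `Ψ_{β,τ}` as a tracial state. -/
def IsPsi.restrict {Ψ : CState (ToeplitzAlgebra S)} (h : IsPsi S β τ Ψ) :
    TracialState (GroupoidCStar V) where
  toCState := restrictState Ψ
  tracial := h.tracial_restrict

theorem fixedTerm_id [DecidableEq V] (v : V) (k : ℕ) :
    fixedTerm S β τ (𝟙 v) k = ((expAdj E β ^ k).mulVec (vertexVector τ) v : ℝ) := by
  rw [← exp_mul_sum_pathN_source, fixedTerm, Complex.ofReal_mul, Complex.ofReal_sum]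
  congr 1
  have hu : ∀ (l : E.Path v) (b : V) (k : l.source ⟶ b), b = l.source → HEq k (𝟙 l.source) →
      τ (GroupoidCStar.u k) = (vertexVector τ l.source : ℂ) := by
    rintro l _ k rfl hk
    rw [eq_of_heq hk, coe_vertexVector]
  rw [Finset.sum_filter]
  refine Finset.sum_congr rfl fun l _ => ?_
  rw [if_pos (S.act_id v l.1)]
  exact hu l.1 _ _ (by rw [act_id]) (S.restr_id_heq v l.1)

/-- At a unit the fixed-path series is the Neumann series applied to x^τ. As A_vN x^τ is
nonnegative, its coordinate sum Z is its 1-norm. -/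
theorem vertexVector_of_isPsi [DecidableEq V]
    (hβ : ENNReal.log (spectralRadius ℂ (E.adjMatrix.map (Int.cast : ℤ → ℂ))) < (β : EReal))
    {Ψ : CState (ToeplitzAlgebra S)} (h : IsPsi S β τ Ψ) {τ' : TracialState (GroupoidCStar V)}
    (hτ' : ∀ a, τ' a = Ψ (incl S a)) :
    vertexVector τ' =
      (l1Norm ((vonNeumannMatrix E β).mulVec (vertexVector τ)))⁻¹ •
        (vonNeumannMatrix E β).mulVec (vertexVector τ) := by
  have hnn : ∀ v, 0 ≤ (vonNeumannMatrix E β).mulVec (vertexVector τ) v := by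
    intro v
    refine (hasSum_expAdj_pow_mulVec hβ (vertexVector τ) v).nonneg fun k => ?_
    rw [← exp_mul_sum_pathN_source]
    exact mul_nonneg (Real.exp_pos _).le (Finset.sum_nonneg fun _ _ => vertexVector_nonneg τ _)
  have hZ : partitionFunction E β τ =
      l1Norm ((vonNeumannMatrix E β).mulVec (vertexVector τ)) := by
    rw [partitionFunction, (hasSum_partitionTerm hβ τ).tsum_eq, l1Norm]
    exact Finset.sum_congr rfl fun v _ => (abs_of_nonneg (hnn v)).symm
  funext v
  apply Complex.ofReal_injective
  rw [coe_vertexVector, hτ', incl_u, h.apply_u]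
  simp only [fixedTerm_id]
  rw [← Complex.ofReal_tsum, (hasSum_expAdj_pow_mulVec hβ (vertexVector τ) v).tsum_eq, hZ,
    Pi.smul_apply, smul_eq_mul, Complex.ofReal_mul, Complex.ofReal_inv]

theorem vertexVector_iterate [DecidableEq V]
    {χ : TracialState (GroupoidCStar V) → TracialState (GroupoidCStar V)} {M : Matrix V V ℝ}
    (hχ : ∀ τ, vertexVector (χ τ) = (l1Norm (M.mulVec (vertexVector τ)))⁻¹ •
      M.mulVec (vertexVector τ)) (τ : TracialState (GroupoidCStar V)) (n : ℕ) :
    vertexVector (χ^[n] τ) = (l1Norm ((M ^ n).mulVec (vertexVector τ)))⁻¹ •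
      (M ^ n).mulVec (vertexVector τ) := by
  have hone : ∀ τ : TracialState (GroupoidCStar V), l1Norm (vertexVector τ) = 1 := by
    intro τ
    rw [← sum_vertexVector τ]
    exact Finset.sum_congr rfl fun v _ => abs_of_nonneg (vertexVector_nonneg τ v)
  induction n with
  | zero => simp [hone]
  | succ n ih =>
    rw [Function.iterate_succ_apply', hχ, ih, Matrix.mulVec_smul, Matrix.mulVec_mulVec, ← pow_succ',
      l1Norm_smul, smul_smul, mul_inv]
    -- If this norm were 0, the inductive formula, with 0⁻¹ = 0, would make the vector of the
    -- iterate zero, whereas it has 1-norm 1. Positivity lets the normalising factors of successive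
    -- steps cancel.
    have hpos : 0 < l1Norm ((M ^ n).mulVec (vertexVector τ)) := by
      have h0 : 0 ≤ l1Norm ((M ^ n).mulVec (vertexVector τ)) :=
        Finset.sum_nonneg fun _ _ => abs_nonneg _
      refine lt_of_le_of_ne h0 fun h => ?_
      have := hone (χ^[n] τ)
      rw [ih, ← h, inv_zero, zero_smul] at this
      simp [l1Norm] at this
    congr 1
    rw [abs_of_pos (inv_pos.2 hpos)]
    field_simp

end Main

end SelfSim

end

open SelfSim in
theorem proposition2p5 {V E₁ : Type u} [Fintype V] [DecidableEq V] [Fintype E₁] [Groupoid.{u} V]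
    (E : DirectedGraph V E₁) (S : SelfSimilarAction E) (hE : E.StronglyConnected) (β : ℝ)
    (hβ : ENNReal.log (spectralRadius ℂ (E.adjMatrix.map (Int.cast : ℤ → ℂ))) < (β : EReal)) :
    -- the matrix `A_vN` is well defined
    IsUnit (oneSubExpAdj E β) ∧
    -- the state `Ψ_{β,τ}` is well defined for every tracial state `τ`
    (∀ τ : TracialState (GroupoidCStar V),
      Summable (partitionTerm E β τ) ∧ 0 < partitionFunction E β τ ∧
        ∃! Ψ : CState (ToeplitzAlgebra S), IsPsi S β τ Ψ) ∧
    -- the map `χ_β` is well defined and has the asserted property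
    ∃ χ : TracialState (GroupoidCStar V) → TracialState (GroupoidCStar V),
      IsChi S β χ ∧ (∀ χ', IsChi S β χ' → χ' = χ) ∧
        ∀ (τ : TracialState (GroupoidCStar V)) (n : ℕ),
          vertexVector (χ^[n] τ) =
            (l1Norm ((vonNeumannMatrix E β ^ n).mulVec (vertexVector τ)))⁻¹ •
              (vonNeumannMatrix E β ^ n).mulVec (vertexVector τ) := by
  have hs := fun τ : TracialState (GroupoidCStar V) => (hasSum_partitionTerm hβ τ).summable
  have hZ := fun τ : TracialState (GroupoidCStar V) => partitionFunction_pos hβ τ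
  have hΨ := fun τ : TracialState (GroupoidCStar V) => isPsi_psiState S (hs τ) (hZ τ)
  refine ⟨isUnit_oneSubExpAdj hβ, fun τ => ⟨hs τ, hZ τ, _, hΨ τ, fun Ψ h => h.unique (hΨ τ)⟩,
    fun τ => (hΨ τ).restrict, fun τ => ⟨_, hΨ τ, fun _ => rfl⟩, fun χ' hχ' => ?_, fun τ n => ?_⟩
  · funext τ
    obtain ⟨Ψ, h, h'⟩ := hχ' τ
    obtain rfl := h.unique (hΨ τ)
    exact TracialState.ext h'
  · exact vertexVector_iterate (fun τ => vertexVector_of_isPsi hβ (hΨ τ) fun _ => rfl) τ n
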